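/- Identify closed curves with maps $\gamma:\mathbb{R}/\mathbb{Z}\to\mathbb{R}^2$. A $C^1$-immersion is *generic* if all its self-intersections are transverse double points. For a generic immersion $\gamma$ let $W(\gamma)$ be its winding number (the degree of the tangent $\gamma'/|\gamma'|$) and $J^+(\gamma),J^-(\gamma),\mathrm{St}(\gamma)$ Arnold's invariants. For $j_+,j_-,s,\omega\in\mathbb{Z}$ a *$(j_\pm,s,\omega)$-compartment* is a (non-empty) path component, with respect to regular homotopy ($C^1$-continuous paths of immersions), of the set of all generic immersions with $J^+=j_+$, $J^-=j_-$, $\mathrm{St}=s$, $W=\omega$. Let $S(\gamma)=\{(u,v): 0\le u<v<1,\ \gamma(u)=\gamma(v)\}=\{(u_1,v_1),\dots,(u_n,v_n)\}$, $T(\gamma)=\{u_1,v_1,\dots,u_n,v_n\}$, let $d_\gamma$ be the intrinsic distance along $\gamma$, and let $\Lambda(\gamma)=\min\{d_\gamma(a,b): a,b\in T(\gamma),\,a\ne b\}$ ($=\infty$ if $n=0$). For $\eta\in(0,1)$ let $\mathcal{F}(\eta,j_\pm,s,\omega)$ be the set of all generic immersions $\gamma\in C^1(\mathbb{R}/\mathbb{Z},\mathbb{R}^2)$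 with $|\gamma'|\equiv1$, $J^+(\gamma)=j_+$, $J^-(\gamma)=j_-$, $\mathrm{St}(\gamma)=s$, $W(\gamma)=\omega$ and $\Lambda(\gamma)\ge2\eta$ that are affine linear on $(u-\eta,u+\eta)$ for every $u\in T(\gamma)$. For $q>2$ and $\delta>0$ put $$\mathrm{TP}_{q,\delta}(\gamma)=\iint_{(\mathbb{R}/\mathbb{Z})^2\setminus Y_\delta(\gamma)}\left(\frac{2\,\mathrm{dist}(\ell(t),\gamma(s))}{|\gamma(t)-\gamma(s)|^2}\right)^q|\gamma'(s)||\gamma'(t)|\,ds\,dt\in[0,\infty],\qquad \ell(t)=\gamma(t)+\mathbb{R}\gamma'(t),$$ where $Y_\delta(\gamma)$ is the set of all $(x,y)$ such that, for some $i$, either $d_\gamma(x,u_i)<\delta$ and $d_\gamma(y,v_i)<\delta$, or $d_\gamma(x,v_i)<\delta$ and $d_\gamma(y,u_i)<\delta$. **Corollary 1.6.** Let $\mathcal{C}$ be a $(j_\pm,s,\omega)$-compartment, $q>2$ and $\eta\in(0,1)$. Let $\delta_k\in(0,\frac\eta2]$ with $\delta_k\to0$, let $\gamma_k$ minimize $\mathrm{TP}_{q,\delta_k}$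 in $\mathcal{F}(\eta,j_\pm,s,\omega)\cap\mathcal{C}$ for every $k$, and suppose that, after suitable translations, $\gamma_k+a_k\to\Gamma^\eta$ in $C^1(\mathbb{R}/\mathbb{Z},\mathbb{R}^2)$ with $a_k\in\mathbb{R}^2$. Then $$\mathrm{TP}_{q,\delta}(\Gamma^\eta)\le\mathrm{TP}_{q,\delta}(\gamma)$$ for every $\delta\in(0,\frac\eta2]$ and every $\gamma\in\mathcal{F}(\eta,j_\pm,s,\omega)\cap\mathcal{C}$ all of whose intersection angles (between the two tangent lines at a self-intersection) equal $\frac\pi2$. -/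

import Mathlib

open Filter Topology MeasureTheory Set
open scoped ENNReal

noncomputable section

namespace PlaneCurve

/-! The Euclidean plane is modelled by `ℂ` (as a real inner product space), and closed curves
`ℝ/ℤ → ℝ²` by `1`-periodic functions `ℝ → ℂ`. -/

/-- Closed plane curves of class `C¹`. -/
structure IsClosedC1 (γ : ℝ → ℂ) : Prop where
  periodic : Function.Periodic γ 1
  contDiff : ContDiff ℝ 1 γ

/-- Closed plane `C¹`-immersions (regular closed curves). -/
structure IsRegularClosed (γ : ℝ → ℂ) : Prop extends IsClosedC1 γ where
  deriv_ne_zero : ∀ t, deriv γ t ≠ 0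

/-- `S(γ)`: the pairs `u < v` of parameters in `ℝ/ℤ ≅ [0,1)` with `γ u = γ v`. -/
def selfInt (γ : ℝ → ℂ) : Set (ℝ × ℝ) :=
  {p | 0 ≤ p.1 ∧ p.1 < p.2 ∧ p.2 < 1 ∧ γ p.1 = γ p.2}

/-- The pair `p` of parameters of a self-intersection has multiplicity two: no further parameter in
`[0,1)` is mapped to the same point. -/
def IsDouble (γ : ℝ → ℂ) (p : ℝ × ℝ) : Prop :=
  ∀ t ∈ Ico (0 : ℝ) 1, γ t = γ p.1 → t = p.1 ∨ t = p.2

/-- The two tangent vectors at the parameters in `p` are not parallel. -/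
def IsTransverse (γ : ℝ → ℂ) (p : ℝ × ℝ) : Prop :=
  LinearIndependent ℝ ![deriv γ p.1, deriv γ p.2]

/-- Generic immersions: there are only finitely many self-intersections (which is automatic by
compactness), and all of them are transverse double points. -/
structure IsGeneric (γ : ℝ → ℂ) : Prop extends IsRegularClosed γ where
  finite : (selfInt γ).Finite
  transverse : ∀ p ∈ selfInt γ, IsTransverse γ p
  double : ∀ p ∈ selfInt γ, IsDouble γ p

/-- The winding number of `γ` is `ω`: the degree of the (normalised) tangent, computed by means of a
continuous angle function `θ` of `γ'`. -/
def HasWinding (γ : ℝ → ℂ) (ω : ℤ) : Prop :=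
  ∃ θ : ℝ → ℝ, Continuous θ ∧
    (∀ t, deriv γ t = (‖deriv γ t‖ : ℂ) * Complex.exp ((θ t : ℂ) * Complex.I)) ∧
    θ 1 - θ 0 = 2 * Real.pi * (ω : ℝ)

/-! ### Regular homotopies and the good part of the discriminant -/

/-- `h` restricted to `[0,1]` is a regular homotopy, that is, a path in the space of closed plane
immersions which is continuous with respect to the `C¹`-topology. -/
structure IsRegularHomotopy (h : ℝ → ℝ → ℂ) : Prop where
  regular : ∀ τ ∈ Icc (0 : ℝ) 1, IsRegularClosed (h τ)
  cont : ContinuousOn (fun p : ℝ × ℝ => h p.1 p.2) (Icc 0 1 ×ˢ univ)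
  cont_deriv : ContinuousOn (fun p : ℝ × ℝ => deriv (h p.1) p.2) (Icc 0 1 ×ˢ univ)

/-- `γ` is generic apart from exactly one self-intersection, which has multiplicity two and
satisfies `tangent (γ' u) (γ' v)`. -/
def IsSelfTangency (tangent : ℂ → ℂ → Prop) (γ : ℝ → ℂ) : Prop :=
  IsRegularClosed γ ∧ (selfInt γ).Finite ∧ (∀ p ∈ selfInt γ, IsDouble γ p) ∧
    ∃ p ∈ selfInt γ, tangent (deriv γ p.1) (deriv γ p.2) ∧
      ∀ p' ∈ selfInt γ, p' ≠ p → IsTransverse γ p'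

/-- `Δᵈ`: one direct self-tangency (tangent vectors in the same direction). -/
def DirectStratum : Set (ℝ → ℂ) :=
  {γ | IsSelfTangency (fun a b => ∃ c : ℝ, 0 < c ∧ b = c • a) γ}

/-- `Δⁱ`: one inverse self-tangency (tangent vectors in opposite directions). -/
def InverseStratum : Set (ℝ → ℂ) :=
  {γ | IsSelfTangency (fun a b => ∃ c : ℝ, c < 0 ∧ b = c • a) γ}

/-- `Δᵗ` with marked parameters: `γ` is generic apart from exactly one transverse triple point,
which is passed at the parameters `u < v < w` of `[0,1)`. -/
def IsTripleCurve (γ : ℝ → ℂ) (u v w : ℝ) : Prop :=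
  IsRegularClosed γ ∧ (selfInt γ).Finite ∧ (∀ p ∈ selfInt γ, IsTransverse γ p) ∧
    (u, v) ∈ selfInt γ ∧ (v, w) ∈ selfInt γ ∧
    (∀ t ∈ Ico (0 : ℝ) 1, γ t = γ u → t = u ∨ t = v ∨ t = w) ∧
    (∀ p ∈ selfInt γ, γ p.1 ≠ γ u → IsDouble γ p)

/-- The number of self-intersections. -/
def numSelfInt (γ : ℝ → ℂ) : ℤ := ((selfInt γ).ncard : ℤ)

/-- At time `τ₀` the number of self-intersections along `h` jumps by `2ε`. -/
def JumpsBy (h : ℝ → ℝ → ℂ) (τ₀ : ℝ) (ε : ℤ) : Prop :=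
  ∃ r > 0, ∀ a ∈ Ioo (τ₀ - r) τ₀, ∀ b ∈ Ioo τ₀ (τ₀ + r),
    numSelfInt (h b) - numSelfInt (h a) = 2 * ε

/-- Sign of a vanishing triangle. Near the parameters `u`, `v`, `w` the curve consists of three
branches 1, 2, 3 that intersect pairwise: branches 1 and 2 at the parameters `a₁₂`, `a₂₁`, branches
1 and 3 at `a₁₃`, `a₃₁`, and branches 2 and 3 at `a₂₃`, `a₃₂`. The cyclic order in which the curve
passes through the sides orients the triangle: side 1 from `P₁₃` to `P₁₂`, side 2 from `P₁₂` to
`P₂₃`, side 3 from `P₂₃` to `P₁₃`. The sign is `(-1) ^ k`, where `k` is the number of sides on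
which the direction of the curve agrees with this orientation, so that each side contributes `-1` if
the directions agree and `1` if not. -/
def TriangleSign (γ : ℝ → ℂ) (u v w r : ℝ) (ε : ℤ) : Prop :=
  ∃ a₁₂ ∈ Ioo (u - r) (u + r), ∃ a₁₃ ∈ Ioo (u - r) (u + r),
  ∃ a₂₁ ∈ Ioo (v - r) (v + r), ∃ a₂₃ ∈ Ioo (v - r) (v + r),
  ∃ a₃₁ ∈ Ioo (w - r) (w + r), ∃ a₃₂ ∈ Ioo (w - r) (w + r),
    γ a₁₂ = γ a₂₁ ∧ γ a₁₃ = γ a₃₁ ∧ γ a₂₃ = γ a₃₂ ∧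
    ε = (-(SignType.sign (a₁₂ - a₁₃) : ℤ)) * (-(SignType.sign (a₂₃ - a₂₁) : ℤ)) *
      (-(SignType.sign (a₃₁ - a₃₂) : ℤ))

/-- Transverse crossing of `Δᵈ` at time `τ₀` with sign `ε`; it is positive if the number of double
points increases. -/
def CrossesDirect (h : ℝ → ℝ → ℂ) (τ₀ : ℝ) (ε : ℤ) : Prop :=
  h τ₀ ∈ DirectStratum ∧ (ε = 1 ∨ ε = -1) ∧ JumpsBy h τ₀ ε

/-- Transverse crossing of `Δⁱ` at time `τ₀` with sign `ε`; it is positive if the number of double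
points increases. -/
def CrossesInverse (h : ℝ → ℝ → ℂ) (τ₀ : ℝ) (ε : ℤ) : Prop :=
  h τ₀ ∈ InverseStratum ∧ (ε = 1 ∨ ε = -1) ∧ JumpsBy h τ₀ ε

/-- Transverse crossing of `Δᵗ` at time `τ₀` with sign `ε`: the vanishing triangle has sign `-ε`
before and the newborn triangle has sign `ε` after the crossing. -/
def CrossesTriple (h : ℝ → ℝ → ℂ) (τ₀ : ℝ) (ε : ℤ) : Prop :=
  ∃ u v w : ℝ, IsTripleCurve (h τ₀) u v w ∧ (ε = 1 ∨ ε = -1) ∧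
    ∀ᶠ r in 𝓝[>] (0 : ℝ),
      (∀ᶠ τ in 𝓝[<] τ₀, TriangleSign (h τ) u v w r (-ε)) ∧
      (∀ᶠ τ in 𝓝[>] τ₀, TriangleSign (h τ) u v w r ε)

/-- Generic paths: regular homotopies that are generic except at finitely many times, namely the
times in `D`, `I`, `T`, at which they cross `Δᵈ`, `Δⁱ`, `Δᵗ`, respectively, transversely with the
sign given by `σ`. -/
structure IsGenericPath (h : ℝ → ℝ → ℂ) (D I T : Finset ℝ) (σ : ℝ → ℤ) : Prop where
  homotopy : IsRegularHomotopy h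
  generic : ∀ τ ∈ Icc (0 : ℝ) 1, τ ∉ D → τ ∉ I → τ ∉ T → IsGeneric (h τ)
  direct : ∀ τ ∈ D, τ ∈ Ioo (0 : ℝ) 1 ∧ CrossesDirect h τ (σ τ)
  inverse : ∀ τ ∈ I, τ ∈ Ioo (0 : ℝ) 1 ∧ CrossesInverse h τ (σ τ)
  triple : ∀ τ ∈ T, τ ∈ Ioo (0 : ℝ) 1 ∧ CrossesTriple h τ (σ τ)

/-! ### Arnold invariants -/

/-- For `k ≥ 0`, the standard curve of winding number `k + 1`: a counterclockwise circle with `k`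
small disjoint inner loops. -/
def loopCurve (k : ℕ) (t : ℝ) : ℂ :=
  Complex.exp (2 * Real.pi * t * Complex.I) +
    (2 / (2 * (k : ℂ) + 1)) * Complex.exp (2 * Real.pi * ((k : ℂ) + 1) * t * Complex.I)

/-- The figure-eight curve. -/
def figureEight (t : ℝ) : ℂ :=
  (Real.sin (2 * Real.pi * t) : ℂ) + (Real.sin (4 * Real.pi * t) : ℂ) * Complex.I

/-- Arnold's representative curve of winding number `ω`. -/
def repCurve (ω : ℤ) : ℝ → ℂ :=
  if ω = 0 then figureEight
  else if 0 < ω then loopCurve (ω.natAbs - 1)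
  else fun t => (starRingEnd ℂ) (loopCurve (ω.natAbs - 1) t)

/-- The prescribed value of `J⁺` on the representative curve of winding number `ω`. -/
def repJplus (ω : ℤ) : ℤ := if ω = 0 then 0 else -2 * (|ω| - 1)

/-- The prescribed value of `J⁻` on the representative curve of winding number `ω`. -/
def repJminus (ω : ℤ) : ℤ := if ω = 0 then -1 else -3 * (|ω| - 1)

/-- The prescribed value of `St` on the representative curve of winding number `ω`. -/
def repSt (ω : ℤ) : ℤ := if ω = 0 then 0 else |ω| - 1

/-- `W(γ) = ω`, `J⁺(γ) = jp`, `J⁻(γ) = jm` and `St(γ) = s`: there is a generic path from the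
representative curve of winding number `ω` to `γ` along which the invariants change from their
prescribed values to `jp`, `jm`, `s` according to Arnold's rules. -/
def HasInvariants (γ : ℝ → ℂ) (jp jm s ω : ℤ) : Prop :=
  HasWinding γ ω ∧
  ∃ (h : ℝ → ℝ → ℂ) (D I T : Finset ℝ) (σ : ℝ → ℤ),
    IsGenericPath h D I T σ ∧ h 0 = repCurve ω ∧ h 1 = γ ∧
    jp = repJplus ω + ∑ τ ∈ D, 2 * σ τ ∧
    jm = repJminus ω + ∑ τ ∈ I, (-2) * σ τ ∧
    s = repSt ω + ∑ τ ∈ T, σ τ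

/-- The set of all generic immersions with the given Arnold invariants and winding number. -/
def genericClass (jp jm s ω : ℤ) : Set (ℝ → ℂ) :=
  {γ | IsGeneric γ ∧ HasInvariants γ jp jm s ω}

/-- `C` is a (non-empty) `(jp, jm, s, ω)`-compartment: a path component, with respect to regular
homotopy, of the set of generic immersions with these invariants. -/
def IsCompartment (jp jm s ω : ℤ) (C : Set (ℝ → ℂ)) : Prop :=
  ∃ γ₀ ∈ genericClass jp jm s ω,
    C = {γ | ∃ h : ℝ → ℝ → ℂ, IsRegularHomotopy h ∧
      (∀ τ ∈ Icc (0 : ℝ) 1, h τ ∈ genericClass jp jm s ω) ∧ h 0 = γ₀ ∧ h 1 = γ}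

/-! ### Admissible curves and the truncated tangent-point energy -/

/-- `d_γ(x, y)`: the intrinsic distance along the closed curve `γ`, that is, the length of the
shorter arc between the parameters `x` and `y` of `ℝ/ℤ`. -/
def arcDist (γ : ℝ → ℂ) (x y : ℝ) : ℝ :=
  ⨅ k : ℤ, |∫ τ in x..(y + (k : ℝ)), ‖deriv γ τ‖|

/-- `T(γ)`: the parameters in `[0,1)` of the self-intersections. -/
def intParams (γ : ℝ → ℂ) : Set ℝ :=
  {a | ∃ p ∈ selfInt γ, a = p.1 ∨ a = p.2}

/-- `Λ(γ)`: the shortest intrinsic distance of distinct parameters in `T(γ)` (`∞` if `γ` has no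
self-intersections). -/
def minArcDist (γ : ℝ → ℂ) : ℝ≥0∞ :=
  ⨅ a ∈ intParams γ, ⨅ b ∈ intParams γ, ⨅ _ : a ≠ b, ENNReal.ofReal (arcDist γ a b)

/-- The class `F(η, j±, s, ω)`: generic immersions parametrized by arclength (hence of length one)
with the given invariants, with `Λ(γ) ≥ 2η`, and affine linear on `(u - η, u + η)` for every
`u ∈ T(γ)`. -/
def admissible (η : ℝ) (jp jm s ω : ℤ) : Set (ℝ → ℂ) :=
  {γ | γ ∈ genericClass jp jm s ω ∧ (∀ t, ‖deriv γ t‖ = 1) ∧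
    ENNReal.ofReal (2 * η) ≤ minArcDist γ ∧
    ∀ u ∈ intParams γ, ∃ p v : ℂ, ∀ x ∈ Ioo (u - η) (u + η), γ x = p + x • v}

/-- `Y_δ(γ)`, as a (doubly periodic) set of pairs of real parameters. -/
def truncSet (γ : ℝ → ℂ) (δ : ℝ) : Set (ℝ × ℝ) :=
  {z | ∃ p ∈ selfInt γ, (arcDist γ z.1 p.1 < δ ∧ arcDist γ z.2 p.2 < δ) ∨
    (arcDist γ z.1 p.2 < δ ∧ arcDist γ z.2 p.1 < δ)}

/-- The affine tangent line of `γ` at the parameter `t`. -/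
def tangentLine (γ : ℝ → ℂ) (t : ℝ) : Set ℂ := {z | ∃ c : ℝ, z = γ t + c • deriv γ t}

/-- The truncated tangent-point energy `TP_{q,δ}(γ)` with values in `[0,∞]`; the pair `z` stands for
the parameters `(s, t)`, and `2 dist(ℓ(t), γ(s)) / |γ(t) - γ(s)|²` is the inverse of the radius of the
circle through `γ(s)` and `γ(t)` that is tangent to the curve at `γ(t)`. -/
def truncEnergy (q δ : ℝ) (γ : ℝ → ℂ) : ℝ≥0∞ :=
  ∫⁻ z in (Ico (0 : ℝ) 1 ×ˢ Ico (0 : ℝ) 1) \ truncSet γ δ,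
    ENNReal.ofReal
      ((2 * Metric.infDist (γ z.1) (tangentLine γ z.2) / ‖γ z.2 - γ z.1‖ ^ 2) ^ q *
        (‖deriv γ z.1‖ * ‖deriv γ z.2‖))

/-- `γ` minimizes `TP_{q,δ}` in the class `A`. -/
def IsEnergyMinimizer (q δ : ℝ) (A : Set (ℝ → ℂ)) (γ : ℝ → ℂ) : Prop :=
  γ ∈ A ∧ ∀ β ∈ A, truncEnergy q δ γ ≤ truncEnergy q δ β

/-- The angle in `[0, π/2]` between the two tangent lines at the parameters in `p`. -/
def intersectionAngle (γ : ℝ → ℂ) (p : ℝ × ℝ) : ℝ :=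
  min (InnerProductGeometry.angle (deriv γ p.1) (deriv γ p.2))
    (Real.pi - InnerProductGeometry.angle (deriv γ p.1) (deriv γ p.2))

/-- Convergence of closed curves in `C¹(ℝ/ℤ, ℝ²)`. -/
def TendstoC1 (γ : ℕ → ℝ → ℂ) (Γ : ℝ → ℂ) : Prop :=
  IsClosedC1 Γ ∧ TendstoUniformly γ Γ atTop ∧
    TendstoUniformly (fun k => deriv (γ k)) (deriv Γ) atTop

end PlaneCurve

end

noncomputable section

namespace PlaneCurve

/-! ### Crossings as pairs of points of the circle -/

/-! Near a crossing an admissible curve consists of two straight segments. Shrinking the truncation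
radius from `δ` to `δ'` therefore adds to the energy one term per ordered crossing, the integral
over a square annulus, and this term depends only on the crossing angle (`truncEnergy_eq_add_sum`,
`setLIntegral_torusAnnulus`). It is least at a right angle, where it has a finite value `L`
(`lineEnergy_right_angle_le`).

All curves of a compartment have the same number `N` of ordered crossings, because transverse double
points persist uniquely under small regular homotopies through generic curves
(`IsCompartment.ncard_crossings_eq`). Let `β` minimize at radius `δ'` and let `γ` have right angles
only. Then `TP_δ β + N L ≤ TP_δ' β ≤ TP_δ' γ = TP_δ γ + N L`, and the finite term `N L` cancels
(`truncEnergy_le_of_minimizer`). No finiteness of the energies themselves is needed.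

It remains to pass to the limit. The truncation sets of the minimizers are controlled by that of `Γ`
only after a small loss of radius, so Fatou's lemma yields `TP_δ Γ ≤ liminf TP_δ' γ_k ≤ TP_δ' γ` for
`δ' < δ` (`truncEnergy_le_liminf`). Letting `δ'` increase to `δ` closes the gap, since the annulus
terms of `γ` tend to zero. -/

/-- The ordered pairs of distinct points of `ℝ/ℤ` that a closed curve maps to the same point. -/
def crossings (γ : ℝ → ℂ) : Set (UnitAddCircle × UnitAddCircle) :=
  {P | ∃ u v : ℝ, P = ((u : UnitAddCircle), (v : UnitAddCircle)) ∧
    (u : UnitAddCircle) ≠ (v : UnitAddCircle) ∧ γ u = γ v}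

theorem exists_int_eq_add_of_coe_eq {u v : ℝ} (h : (u : UnitAddCircle) = v) :
    ∃ n : ℤ, u = v + n := by
  have h1 : ((u - v : ℝ) : UnitAddCircle) = 0 := by
    rw [AddCircle.coe_sub, h, sub_self]
  obtain ⟨n, hn⟩ := (AddCircle.coe_eq_zero_iff (1 : ℝ)).1 h1
  refine ⟨n, ?_⟩
  simp at hn
  linarith

theorem coe_add_int (u : ℝ) (n : ℤ) : ((u + n : ℝ) : UnitAddCircle) = u := by
  have h : ((n : ℝ) : UnitAddCircle) = 0 :=
    (AddCircle.coe_eq_zero_iff (1 : ℝ)).2 ⟨n, by simp⟩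
  rw [AddCircle.coe_add, h, add_zero]

theorem apply_eq_of_coe_eq {E : Type*} {f : ℝ → E} (hf : Function.Periodic f 1) {u v : ℝ}
    (h : (u : UnitAddCircle) = v) : f u = f v := by
  obtain ⟨n, rfl⟩ := exists_int_eq_add_of_coe_eq h
  simpa using hf.int_mul n v

theorem exists_mem_Ico_coe_eq (u : ℝ) :
    ∃ u' ∈ Ico (0 : ℝ) 1, (u' : UnitAddCircle) = u := by
  refine ⟨Int.fract u, ⟨Int.fract_nonneg u, Int.fract_lt_one u⟩, ?_⟩
  conv_rhs => rw [← Int.fract_add_floor u, coe_add_int]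

theorem coe_injOn_Ico {u v : ℝ} (hu : u ∈ Ico (0 : ℝ) 1) (hv : v ∈ Ico (0 : ℝ) 1)
    (h : (u : UnitAddCircle) = v) : u = v := by
  refine (AddCircle.coe_eq_coe_iff_of_mem_Ico (p := (1 : ℝ)) (a := 0) ?_ ?_).1 h <;> simpa

theorem periodic_deriv {γ : ℝ → ℂ} (hγ : Function.Periodic γ 1) :
    Function.Periodic (deriv γ) 1 := by
  intro t
  have h : (fun s => γ (s + 1)) = γ := funext hγ
  rw [← deriv_comp_add_const, h]

theorem coe_mem_crossings {γ : ℝ → ℂ} (hγ : Function.Periodic γ 1) {u v : ℝ} :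
    ((u : UnitAddCircle), (v : UnitAddCircle)) ∈ crossings γ ↔
      (u : UnitAddCircle) ≠ v ∧ γ u = γ v := by
  constructor
  · rintro ⟨u', v', h, hne, heq⟩
    obtain ⟨h1, h2⟩ := Prod.ext_iff.1 h
    simp only at h1 h2
    rw [h1, h2, apply_eq_of_coe_eq hγ h1, apply_eq_of_coe_eq hγ h2]
    exact ⟨hne, heq⟩
  · rintro ⟨hne, heq⟩
    exact ⟨u, v, rfl, hne, heq⟩

/-- Up to order and integer translations, a crossing is a self-intersection in `[0, 1)`. -/
theorem exists_selfInt_of_crossing {γ : ℝ → ℂ} (hγ : Function.Periodic γ 1) {u v : ℝ}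
    (hne : (u : UnitAddCircle) ≠ v) (heq : γ u = γ v) :
    ∃ p ∈ selfInt γ, ((p.1 : UnitAddCircle) = u ∧ (p.2 : UnitAddCircle) = v) ∨
      ((p.2 : UnitAddCircle) = u ∧ (p.1 : UnitAddCircle) = v) := by
  obtain ⟨u', hu', hu⟩ := exists_mem_Ico_coe_eq u
  obtain ⟨v', hv', hv⟩ := exists_mem_Ico_coe_eq v
  have hne' : u' ≠ v' := by
    rintro rfl
    exact hne (hu.symm.trans hv)
  have heq' : γ u' = γ v' := by
    rw [apply_eq_of_coe_eq hγ hu, apply_eq_of_coe_eq hγ hv, heq]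
  rcases lt_or_gt_of_ne hne' with h | h
  · exact ⟨(u', v'), ⟨hu'.1, h, hv'.2, heq'⟩, Or.inl ⟨hu, hv⟩⟩
  · exact ⟨(v', u'), ⟨hv'.1, h, hu'.2, heq'.symm⟩, Or.inr ⟨hu, hv⟩⟩

theorem coe_ne_of_mem_selfInt {γ : ℝ → ℂ} {p : ℝ × ℝ} (hp : p ∈ selfInt γ) :
    (p.1 : UnitAddCircle) ≠ p.2 := fun h =>
  hp.2.1.ne (coe_injOn_Ico ⟨hp.1, hp.2.1.trans hp.2.2.1⟩ ⟨hp.1.trans hp.2.1.le, hp.2.2.1⟩ h)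

theorem finite_crossings {γ : ℝ → ℂ} (hγ : Function.Periodic γ 1) (h : (selfInt γ).Finite) :
    (crossings γ).Finite := by
  refine ((h.image fun p : ℝ × ℝ => ((p.1 : UnitAddCircle), (p.2 : UnitAddCircle))).union
    (h.image fun p : ℝ × ℝ => ((p.2 : UnitAddCircle), (p.1 : UnitAddCircle)))).subset ?_
  rintro P ⟨u, v, rfl, hne, heq⟩
  obtain ⟨p, hp, h | h⟩ := exists_selfInt_of_crossing hγ hne heq
  · exact Or.inl ⟨p, hp, Prod.ext h.1 h.2⟩
  · exact Or.inr ⟨p, hp, Prod.ext h.1 h.2⟩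

/-! ### The cross product of plane vectors -/

/-- The cross product `v × w` of plane vectors. -/
def cross (v w : ℂ) : ℝ := v.re * w.im - v.im * w.re

/-- The scalar product of plane vectors. -/
def dot (v w : ℂ) : ℝ := v.re * w.re + v.im * w.im

theorem dot_sq_add_cross_sq (v w : ℂ) :
    dot v w ^ 2 + cross v w ^ 2 = ‖v‖ ^ 2 * ‖w‖ ^ 2 := by
  rw [Complex.sq_norm, Complex.sq_norm, Complex.normSq_apply, Complex.normSq_apply, dot, cross]
  ring

theorem cross_swap (v w : ℂ) : cross w v = -cross v w := by
  simp only [cross]; ring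

theorem dot_comm (v w : ℂ) : dot w v = dot v w := by
  simp only [dot]; ring

theorem cross_ne_zero_of_linearIndependent {v w : ℂ} (h : LinearIndependent ℝ ![v, w]) :
    cross v w ≠ 0 := by
  intro h0
  rw [LinearIndependent.pair_iff] at h
  simp only [cross] at h0
  -- If the cross product vanishes, both `w.re • v - v.re • w` and `w.im • v - v.im • w` are zero,
  -- so independence forces `v = 0`.
  have h1 := h w.re (-v.re) (by
    apply Complex.ext <;> simp <;> linarith)
  have h2 := h w.im (-v.im) (by
    apply Complex.ext <;> simp <;> linarith)
  have hv : v = 0 := Complex.ext (by simpa using h1.2) (by simpa using h2.2)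
  have := h 1 0 (by simp [hv])
  simp at this

theorem IsGeneric.cross_ne_zero {γ : ℝ → ℂ} (hγ : IsGeneric γ) {u v : ℝ}
    (hne : (u : UnitAddCircle) ≠ v) (heq : γ u = γ v) :
    cross (deriv γ u) (deriv γ v) ≠ 0 := by
  have hd := periodic_deriv hγ.periodic
  obtain ⟨p, hp, h | h⟩ := exists_selfInt_of_crossing hγ.periodic hne heq
  · rw [← apply_eq_of_coe_eq hd h.1, ← apply_eq_of_coe_eq hd h.2]
    exact cross_ne_zero_of_linearIndependent (hγ.transverse p hp)
  · rw [← apply_eq_of_coe_eq hd h.1, ← apply_eq_of_coe_eq hd h.2, cross_swap]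
    exact neg_ne_zero.2 (cross_ne_zero_of_linearIndependent (hγ.transverse p hp))

/-! ### Intrinsic distance and truncation of curves parametrized by arclength -/

/-- At unit speed the arcs from `x` to the translates of `y` have lengths `|y + k - x|`; the least
one is attained at `k = round (x - y)`. -/
theorem arcDist_eq_norm {γ : ℝ → ℂ} (h : ∀ t, ‖deriv γ t‖ = 1) (x y : ℝ) :
    arcDist γ x y = ‖((x - y : ℝ) : UnitAddCircle)‖ := by
  have h1 : arcDist γ x y = ⨅ k : ℤ, |y + k - x| := by
    simp [arcDist, h]
  rw [h1]
  apply le_antisymm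
  · refine (ciInf_le ⟨0, ?_⟩ (round (x - y))).trans_eq ?_
    · rintro _ ⟨k, rfl⟩
      exact abs_nonneg _
    · rw [UnitAddCircle.norm_eq, abs_sub_comm]
      congr 1
      ring
  · refine le_ciInf fun k => ?_
    rw [UnitAddCircle.norm_eq]
    refine (round_le (x - y) k).trans_eq ?_
    rw [abs_sub_comm]
    congr 1
    ring

/-- Using ordered crossings merges the two symmetric alternatives in the truncation set into one
condition on the torus. -/
theorem mem_truncSet_iff {γ : ℝ → ℂ} (hγ : Function.Periodic γ 1) (h : ∀ t, ‖deriv γ t‖ = 1)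
    {δ : ℝ} {z : ℝ × ℝ} :
    z ∈ truncSet γ δ ↔ ∃ P ∈ crossings γ, ‖(z.1 : UnitAddCircle) - P.1‖ < δ ∧
      ‖(z.2 : UnitAddCircle) - P.2‖ < δ := by
  simp only [truncSet, arcDist_eq_norm h, mem_ofPred_eq, AddCircle.coe_sub]
  constructor
  · rintro ⟨p, hp, h | h⟩
    · exact ⟨_, (coe_mem_crossings hγ).2 ⟨coe_ne_of_mem_selfInt hp, hp.2.2.2⟩, h⟩
    · exact ⟨_, (coe_mem_crossings hγ).2 ⟨(coe_ne_of_mem_selfInt hp).symm, hp.2.2.2.symm⟩, h⟩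
  · rintro ⟨_, ⟨u, v, rfl, hne, heq⟩, h⟩
    obtain ⟨p, hp, h' | h'⟩ := exists_selfInt_of_crossing hγ hne heq
    · exact ⟨p, hp, Or.inl (by rwa [h'.1, h'.2])⟩
    · exact ⟨p, hp, Or.inr (by rwa [h'.1, h'.2])⟩

theorem isOpen_truncSet {γ : ℝ → ℂ} (hγ : Function.Periodic γ 1) (h : ∀ t, ‖deriv γ t‖ = 1)
    (δ : ℝ) : IsOpen (truncSet γ δ) := by
  have : truncSet γ δ = ⋃ P ∈ crossings γ, {z : ℝ × ℝ | ‖(z.1 : UnitAddCircle) - P.1‖ < δ} ∩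
      {z : ℝ × ℝ | ‖(z.2 : UnitAddCircle) - P.2‖ < δ} := by
    ext z
    simp only [mem_truncSet_iff hγ h, mem_iUnion, exists_prop]
    rfl
  rw [this]
  have hc : Continuous (fun x : ℝ => (x : UnitAddCircle)) := AddCircle.continuous_mk' 1
  refine isOpen_biUnion fun P _ => IsOpen.inter ?_ ?_
  · exact isOpen_lt ((hc.comp continuous_fst).sub continuous_const).norm continuous_const
  · exact isOpen_lt ((hc.comp continuous_snd).sub continuous_const).norm continuous_const

/-! ### The integrand of the energy -/

/-- The integrand of the tangent-point energy for curves parametrized by arclength. -/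
def tpDensity (q : ℝ) (γ : ℝ → ℂ) (z : ℝ × ℝ) : ℝ≥0∞ :=
  ENNReal.ofReal ((2 * |cross (deriv γ z.2) (γ z.1 - γ z.2)| / ‖γ z.2 - γ z.1‖ ^ 2) ^ q)

/-- The foot of the perpendicular attains the distance. Conversely, by `dot_sq_add_cross_sq`, the
cross product with a unit vector never exceeds the norm. -/
theorem infDist_tangentLine {γ : ℝ → ℂ} {t : ℝ} (h : ‖deriv γ t‖ = 1) (w : ℂ) :
    Metric.infDist w (tangentLine γ t) = |cross (deriv γ t) (w - γ t)| := by
  set v := deriv γ t with hv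
  have hsq : v.re ^ 2 + v.im ^ 2 = 1 := by
    have := Complex.sq_norm v
    rw [h, Complex.normSq_apply] at this
    linarith
  have hne : (tangentLine γ t).Nonempty := ⟨_, 0, rfl⟩
  apply le_antisymm
  · have hmem : γ t + (dot v (w - γ t)) • v ∈ tangentLine γ t := ⟨_, rfl⟩
    refine (Metric.infDist_le_dist_of_mem hmem).trans_eq ?_
    rw [Complex.dist_eq, Complex.norm_eq_sqrt_sq_add_sq, ← Real.sqrt_sq_eq_abs]
    congr 1
    simp only [dot, cross, Complex.sub_re, Complex.sub_im, Complex.add_re, Complex.add_im,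
      Complex.real_smul, Complex.re_ofReal_mul, Complex.im_ofReal_mul]
    generalize w.re = a, w.im = b, (γ t).re = c, (γ t).im = d, v.re = e, v.im = f at hsq ⊢
    have h2 : f ^ 2 = 1 - e ^ 2 := by linarith
    have h3 : f ^ 4 = (1 - e ^ 2) ^ 2 := by rw [← h2]; ring
    ring_nf
    rw [h3, show f ^ 3 = f * f ^ 2 by ring, h2]
    ring
  · rw [Metric.le_infDist hne]
    rintro _ ⟨c, rfl⟩
    rw [Complex.dist_eq]
    -- Moving the base point along the line leaves the cross product with `v` unchanged.
    have h1 : cross v (w - γ t) = cross v (w - (γ t + c • v)) := by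
      simp only [cross, Complex.sub_re, Complex.sub_im, Complex.add_re, Complex.add_im,
        Complex.real_smul, Complex.re_ofReal_mul, Complex.im_ofReal_mul]
      ring
    rw [h1]
    refine abs_le_of_sq_le_sq ?_ (norm_nonneg _)
    have h2 := dot_sq_add_cross_sq v (w - (γ t + c • v))
    rw [h, one_pow, one_mul] at h2
    nlinarith [sq_nonneg (dot v (w - (γ t + c • v)))]

theorem truncEnergy_eq {γ : ℝ → ℂ} (h : ∀ t, ‖deriv γ t‖ = 1) (q δ : ℝ) :
    truncEnergy q δ γ =
      ∫⁻ z in (Ico (0 : ℝ) 1 ×ˢ Ico (0 : ℝ) 1) \ truncSet γ δ, tpDensity q γ z := by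
  simp only [truncEnergy, tpDensity, infDist_tangentLine (h _), h, mul_one]

theorem measurable_tpDensity {γ : ℝ → ℂ} (hγ : ContDiff ℝ 1 γ) (q : ℝ) :
    Measurable (tpDensity q γ) := by
  have h0 : Measurable γ := hγ.continuous.measurable
  have h1 : Measurable (deriv γ) := measurable_deriv γ
  unfold tpDensity cross
  have e1 : Measurable fun z : ℝ × ℝ => γ z.1 := h0.comp measurable_fst
  have e2 : Measurable fun z : ℝ × ℝ => γ z.2 := h0.comp measurable_snd
  have e3 : Measurable fun z : ℝ × ℝ => deriv γ z.2 := h1.comp measurable_snd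
  refine (Measurable.pow_const ?_ q).ennreal_ofReal
  refine Measurable.div ?_ ((e2.sub e1).norm.pow_const 2)
  refine Measurable.const_mul (Measurable.abs ?_) 2
  exact ((Complex.measurable_re.comp e3).mul (Complex.measurable_im.comp (e1.sub e2))).sub
    ((Complex.measurable_im.comp e3).mul (Complex.measurable_re.comp (e1.sub e2)))

/-! ### The number of crossings is constant along homotopies of generic curves -/

/-- Around the points of `Z₀` choose disjoint neighbourhoods, each containing exactly one point of
`Z τ`. What remains of the space is compact, so finitely many neighbourhoods from `h2` cover it, and
eventually no point of `Z τ` lies there. -/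
theorem eventually_ncard_eq_of_locally_unique {X ι : Type*} [TopologicalSpace X] [T2Space X]
    [CompactSpace X] {l : Filter ι} {Z : ι → Set X} {Z₀ : Set X} (hfin : Z₀.Finite)
    (h1 : ∀ x ∈ Z₀, ∀ W ∈ 𝓝 x, ∃ U ∈ 𝓝 x, U ⊆ W ∧ ∀ᶠ τ in l, ∃! z, z ∈ Z τ ∧ z ∈ U)
    (h2 : ∀ x ∉ Z₀, ∃ U ∈ 𝓝 x, ∀ᶠ τ in l, ∀ z ∈ U, z ∉ Z τ) :
    ∀ᶠ τ in l, (Z τ).ncard = Z₀.ncard := by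
  obtain ⟨W, hW, hdisj⟩ := hfin.t2_separation
  choose! U hU hUW huniq using fun x hx => h1 x hx (W x) ((hW x).2.mem_nhds (hW x).1)
  have hK : IsCompact (⋃ x ∈ Z₀, interior (U x))ᶜ :=
    (isOpen_biUnion fun x _ => isOpen_interior).isClosed_compl.isCompact
  have hrest : ∀ᶠ τ in l, ∀ z ∈ (⋃ x ∈ Z₀, interior (U x))ᶜ, z ∉ Z τ := by
    refine hK.induction_on (p := fun s => ∀ᶠ τ in l, ∀ z ∈ s, z ∉ Z τ) (by simp)
      (fun s t hst ht => ht.mono fun τ h z hz => h z (hst hz))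
      (fun s t hs ht => by
        filter_upwards [hs, ht] with τ h h' z hz
        exact hz.elim (h z) (h' z)) ?_
    intro x hx
    have hx0 : x ∉ Z₀ := fun h =>
      hx (mem_biUnion h (mem_interior_iff_mem_nhds.2 (hU x h)))
    obtain ⟨V, hV, hV'⟩ := h2 x hx0
    exact ⟨V, mem_nhdsWithin_of_mem_nhds hV, hV'⟩
  have hall : ∀ᶠ τ in l, ∀ x ∈ Z₀, ∃! z, z ∈ Z τ ∧ z ∈ U x :=
    (hfin.eventually_all).2 huniq
  filter_upwards [hrest, hall] with τ hr ha
  choose! z hz hz' using ha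
  have himage : Z τ = z '' Z₀ := by
    apply Subset.antisymm
    · intro y hy
      have : y ∈ ⋃ x ∈ Z₀, interior (U x) := by
        by_contra hcon
        exact hr y hcon hy
      obtain ⟨x, hx, hyx⟩ := mem_iUnion₂.1 this
      exact ⟨x, hx, (hz' x hx y ⟨hy, interior_subset hyx⟩).symm⟩
    · rintro _ ⟨x, hx, rfl⟩
      exact (hz x hx).1
  rw [himage]
  refine InjOn.ncard_image ?_
  intro x hx y hy hxy
  by_contra hne
  refine (Set.disjoint_left.1 (hdisj hx hy hne)) (hUW x hx (hz x hx).2) ?_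
  rw [hxy]
  exact hUW y hy (hz y hy).2

/-- This is the mean value inequality for `h τ t - t • deriv (h τ₀) u`, whose derivative is small
for `(τ, t)` near `(τ₀, u)` by joint continuity. The radius `r` does not depend on `τ`. -/
theorem IsRegularHomotopy.exists_approx {h : ℝ → ℝ → ℂ} (hh : IsRegularHomotopy h) {τ₀ : ℝ}
    (hτ₀ : τ₀ ∈ Icc (0 : ℝ) 1) (u : ℝ) {c : ℝ} (hc : 0 < c) :
    ∃ r > 0, ∀ᶠ τ in 𝓝[Icc 0 1] τ₀, ∀ x ∈ Metric.ball u r, ∀ y ∈ Metric.ball u r,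
      ‖h τ x - h τ y - (x - y) • deriv (h τ₀) u‖ ≤ c * |x - y| := by
  have h1 := hh.cont_deriv (τ₀, u) ⟨hτ₀, mem_univ _⟩
  have h2 : ∀ᶠ p in 𝓝[Icc 0 1 ×ˢ univ] (τ₀, u),
      ‖deriv (h p.1) p.2 - deriv (h τ₀) u‖ < c := by
    have := h1 (Metric.ball_mem_nhds _ hc)
    filter_upwards [this] with p hp
    simpa [dist_eq_norm] using hp
  rw [nhdsWithin_prod_eq, nhdsWithin_univ] at h2
  obtain ⟨pa, ha, pb, hb, hab⟩ := Filter.eventually_prod_iff.1 h2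
  obtain ⟨r, hr, hrb⟩ := Metric.eventually_nhds_iff_ball.1 hb
  refine ⟨r, hr, ?_⟩
  filter_upwards [ha, self_mem_nhdsWithin] with τ hτ hτI x hx y hy
  have hd : Differentiable ℝ (h τ) := ((hh.regular τ hτI).contDiff).differentiable (by norm_num)
  have h3 := (convex_ball u r).norm_image_sub_le_of_norm_hasDerivWithin_le
    (f := fun t : ℝ => h τ t - t • deriv (h τ₀) u)
    (f' := fun t => deriv (h τ) t - (1 : ℝ) • deriv (h τ₀) u) (C := c)
    (fun t _ => ((hd t).hasDerivAt.sub ((hasDerivAt_id t).smul_const _)).hasDerivWithinAt)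
    (fun t ht => by simpa using (hab hτ (hrb t ht)).le) hy hx
  rw [Real.norm_eq_abs] at h3
  have h4 : h τ x - h τ y - (x - y) • deriv (h τ₀) u =
      h τ x - x • deriv (h τ₀) u - (h τ y - y • deriv (h τ₀) u) := by
    rw [sub_smul]
    abel
  rw [h4]
  exact h3

/-- The invertible linear map `(a, b) ↦ a v - b w` for linearly independent `v` and `w`. -/
def pairEquiv (v w : ℂ) (h : cross v w ≠ 0) : (ℝ × ℝ) ≃L[ℝ] ℂ :=
  LinearEquiv.toContinuousLinearEquiv
    { toFun := fun p => p.1 • v - p.2 • w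
      map_add' := fun p p' => by simp only [Prod.fst_add, Prod.snd_add, add_smul]; abel
      map_smul' := fun c p => by simp [mul_smul, smul_sub]
      invFun := fun z => (cross z w / cross v w, cross z v / cross v w)
      left_inv := fun p => by
        apply Prod.ext <;> simp only <;> rw [div_eq_iff h] <;>
        simp only [cross, Complex.sub_re, Complex.sub_im, Complex.real_smul,
          Complex.re_ofReal_mul, Complex.im_ofReal_mul] <;> ring
      right_inv := fun z => by
        apply Complex.ext <;>
        simp only [Complex.sub_re, Complex.sub_im, Complex.real_smul,
          Complex.re_ofReal_mul, Complex.im_ofReal_mul] <;>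
        rw [div_mul_eq_mul_div, div_mul_eq_mul_div, ← sub_div, div_eq_iff h] <;>
        simp only [cross] <;> ring }

theorem pairEquiv_apply (v w : ℂ) (h : cross v w ≠ 0) (p : ℝ × ℝ) :
    pairEquiv v w h p = p.1 • v - p.2 • w := rfl

theorem IsRegularHomotopy.tendsto {h : ℝ → ℝ → ℂ} (hh : IsRegularHomotopy h) {τ₀ : ℝ}
    (hτ₀ : τ₀ ∈ Icc (0 : ℝ) 1) (u : ℝ) :
    Tendsto (fun p : ℝ × ℝ => h p.1 p.2) (𝓝[Icc 0 1] τ₀ ×ˢ 𝓝 u) (𝓝 (h τ₀ u)) := by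
  have h1 := hh.cont (τ₀, u) ⟨hτ₀, mem_univ _⟩
  rwa [ContinuousWithinAt, nhdsWithin_prod_eq, nhdsWithin_univ] at h1

/-- A quantitative inverse function theorem, uniform in `τ`, for `(x, y) ↦ h τ x - h τ y`. Its
linear model `pairEquiv` is invertible by transversality; approximate linearity gives injectivity,
and also surjectivity onto a ball that contains `0` once `τ` is close to `τ₀`. -/
theorem IsRegularHomotopy.exists_unique_crossing {h : ℝ → ℝ → ℂ} (hh : IsRegularHomotopy h)
    {τ₀ : ℝ} (hτ₀ : τ₀ ∈ Icc (0 : ℝ) 1) {u v : ℝ} (heq : h τ₀ u = h τ₀ v)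
    (hcross : cross (deriv (h τ₀) u) (deriv (h τ₀) v) ≠ 0) {R : ℝ} (hR : 0 < R) :
    ∃ r > 0, r ≤ R ∧ ∀ᶠ τ in 𝓝[Icc 0 1] τ₀,
      ∃! p : ℝ × ℝ, p ∈ Metric.closedBall (u, v) r ∧ h τ p.1 = h τ p.2 := by
  set A := pairEquiv _ _ hcross with hA
  have hN : 0 < ‖(A.symm : ℂ →L[ℝ] ℝ × ℝ)‖₊ := by
    rcases A.subsingleton_or_nnnorm_symm_pos with hs | hs
    · exact absurd hs (not_subsingleton _)
    · exact hs
  set c : NNReal := ‖(A.symm : ℂ →L[ℝ] ℝ × ℝ)‖₊⁻¹ / 2 with hc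
  have hc0 : 0 < c := by positivity
  have hcN : c < ‖(A.symm : ℂ →L[ℝ] ℝ × ℝ)‖₊⁻¹ := NNReal.half_lt_self (by positivity)
  -- Each of the two branches may use half of the admissible error `c`.
  have hc0' : (0 : ℝ) < (c : ℝ) / 2 := by positivity
  obtain ⟨r₁, hr₁, he₁⟩ := hh.exists_approx hτ₀ u hc0'
  obtain ⟨r₂, hr₂, he₂⟩ := hh.exists_approx hτ₀ v hc0'
  set r := min R (min r₁ r₂ / 2) with hr
  have hmin : 0 < min r₁ r₂ := lt_min hr₁ hr₂
  have hr0 : 0 < r := lt_min hR (by positivity)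
  have hrr₁ : r < r₁ := by
    have := min_le_right R (min r₁ r₂ / 2)
    have := min_le_left r₁ r₂
    linarith
  have hrr₂ : r < r₂ := by
    have := min_le_right R (min r₁ r₂ / 2)
    have := min_le_right r₁ r₂
    linarith
  refine ⟨r, hr0, min_le_left _ _, ?_⟩
  have hzero : Tendsto (fun τ => h τ u - h τ v) (𝓝[Icc 0 1] τ₀) (𝓝 0) := by
    have a1 : Tendsto (fun τ => h τ u) (𝓝[Icc 0 1] τ₀) (𝓝 (h τ₀ u)) :=
      (hh.tendsto hτ₀ u).comp (tendsto_id.prodMk tendsto_const_nhds)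
    have a2 : Tendsto (fun τ => h τ v) (𝓝[Icc 0 1] τ₀) (𝓝 (h τ₀ v)) :=
      (hh.tendsto hτ₀ v).comp (tendsto_id.prodMk tendsto_const_nhds)
    simpa [heq] using a1.sub a2
  have hpos : 0 < (((‖(A.symm : ℂ →L[ℝ] ℝ × ℝ)‖₊⁻¹ : NNReal) : ℝ) - c) * r :=
    mul_pos (sub_pos.2 (by exact_mod_cast hcN)) hr0
  filter_upwards [he₁, he₂, hzero (Metric.closedBall_mem_nhds _ hpos)] with τ h₁ h₂ h₃
  have happ : ApproximatesLinearOn (fun p : ℝ × ℝ => h τ p.1 - h τ p.2)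
      (A : (ℝ × ℝ) →L[ℝ] ℂ) (Metric.closedBall (u, v) r) c := by
    intro p hp p' hp'
    rw [← closedBall_prod_same] at hp hp'
    have e₁ := h₁ p.1 (Metric.closedBall_subset_ball hrr₁ hp.1) p'.1
      (Metric.closedBall_subset_ball hrr₁ hp'.1)
    have e₂ := h₂ p.2 (Metric.closedBall_subset_ball hrr₂ hp.2) p'.2
      (Metric.closedBall_subset_ball hrr₂ hp'.2)
    have n₁ : |p.1 - p'.1| ≤ ‖p - p'‖ := norm_fst_le (p - p')
    have n₂ : |p.2 - p'.2| ≤ ‖p - p'‖ := norm_snd_le (p - p')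
    have e₃ : h τ p.1 - h τ p.2 - (h τ p'.1 - h τ p'.2) - A (p - p') =
        (h τ p.1 - h τ p'.1 - (p.1 - p'.1) • deriv (h τ₀) u) -
          (h τ p.2 - h τ p'.2 - (p.2 - p'.2) • deriv (h τ₀) v) := by
      rw [hA, pairEquiv_apply, Prod.fst_sub, Prod.snd_sub]
      abel
    have e₄ := norm_sub_le (h τ p.1 - h τ p'.1 - (p.1 - p'.1) • deriv (h τ₀) u)
      (h τ p.2 - h τ p'.2 - (p.2 - p'.2) • deriv (h τ₀) v)
    rw [← e₃] at e₄
    have m₁ := mul_le_mul_of_nonneg_left n₁ hc0'.le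
    have m₂ := mul_le_mul_of_nonneg_left n₂ hc0'.le
    refine e₄.trans ?_
    linarith
  have hsurj := happ.surjOn_closedBall_of_nonlinearRightInverse A.toNonlinearRightInverse
    hr0.le Subset.rfl
  have h0 : (0 : ℂ) ∈ Metric.closedBall ((fun p : ℝ × ℝ => h τ p.1 - h τ p.2) (u, v))
      (((A.toNonlinearRightInverse.nnnorm : ℝ)⁻¹ - c) * r) := by
    rw [Metric.mem_closedBall_comm]
    exact h₃
  obtain ⟨p, hp, hp0⟩ := hsurj h0
  refine ⟨p, ⟨hp, sub_eq_zero.1 hp0⟩, ?_⟩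
  rintro p' ⟨hp', hp'0⟩
  refine (happ.injOn (Or.inr hcN)) hp' hp ?_
  simp only at hp0 ⊢
  rw [hp0, hp'0, sub_self]

theorem image_coe_mem_nhds {s : Set (ℝ × ℝ)} {u v : ℝ} (hs : s ∈ 𝓝 (u, v)) :
    (Prod.map (fun x : ℝ => (x : UnitAddCircle)) (fun x : ℝ => (x : UnitAddCircle))) '' s ∈
      𝓝 ((u : UnitAddCircle), (v : UnitAddCircle)) := by
  have h1 : IsOpenMap (fun x : ℝ => (x : UnitAddCircle)) := QuotientAddGroup.isOpenMap_coe
  exact (h1.prodMap h1).image_mem_nhds hs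

/-- Three kinds of points of the torus occur: crossings of `h τ₀` persist uniquely, the diagonal
repels crossings because immersions are locally injective uniformly in `τ`, and elsewhere the two
image points stay apart. -/
theorem IsRegularHomotopy.eventually_ncard_crossings_eq {h : ℝ → ℝ → ℂ}
    (hh : IsRegularHomotopy h) {τ₀ : ℝ} (hτ₀ : τ₀ ∈ Icc (0 : ℝ) 1) (hg : IsGeneric (h τ₀)) :
    ∀ᶠ τ in 𝓝[Icc 0 1] τ₀, (crossings (h τ)).ncard = (crossings (h τ₀)).ncard := by
  have hcoe : Continuous (Prod.map (fun x : ℝ => (x : UnitAddCircle))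
      (fun x : ℝ => (x : UnitAddCircle))) :=
    (AddCircle.continuous_mk' 1).prodMap (AddCircle.continuous_mk' 1)
  refine eventually_ncard_eq_of_locally_unique
    (finite_crossings hg.periodic hg.finite) ?_ ?_
  · rintro _ ⟨u, v, rfl, hne, heq⟩ W hW
    -- Staying off the diagonal ensures that the zero found below is a pair of distinct points of
    -- the circle.
    have hW' : W ∩ {P | P.1 ≠ P.2} ∈ 𝓝 ((u : UnitAddCircle), (v : UnitAddCircle)) :=
      inter_mem hW ((isOpen_ne_fun continuous_fst continuous_snd).mem_nhds hne)
    obtain ⟨R, hR, hRW⟩ := Metric.nhds_basis_closedBall.mem_iff.1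
      (hcoe.continuousAt (x := (u, v)) hW')
    obtain ⟨r, hr, hrR, hev⟩ := hh.exists_unique_crossing hτ₀ heq (hg.cross_ne_zero hne heq) hR
    have hsub := (Metric.closedBall_subset_closedBall hrR).trans hRW
    refine ⟨_, image_coe_mem_nhds (Metric.closedBall_mem_nhds (u, v) hr), ?_, ?_⟩
    · rintro _ ⟨p, hp, rfl⟩
      exact (hsub hp).1
    · filter_upwards [hev, self_mem_nhdsWithin] with τ hτ hτI
      have hper := (hh.regular τ hτI).periodic
      obtain ⟨p, ⟨hp, hp0⟩, huniq⟩ := hτ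
      refine ⟨_, ⟨⟨p.1, p.2, rfl, (hsub hp).2, hp0⟩, p, hp, rfl⟩, ?_⟩
      rintro _ ⟨hz, p', hp', rfl⟩
      have := ((coe_mem_crossings hper).1 hz).2
      rw [huniq p' ⟨hp', this⟩]
      rfl
  · rintro ⟨x, y⟩ hxy
    obtain ⟨u, rfl⟩ := QuotientAddGroup.mk_surjective x
    obtain ⟨v, rfl⟩ := QuotientAddGroup.mk_surjective y
    by_cases hne : (u : UnitAddCircle) = v
    · have hw : 0 < ‖deriv (h τ₀) u‖ / 2 := by
        have := norm_pos_iff.2 (hg.deriv_ne_zero u)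
        positivity
      obtain ⟨r, hr, hev⟩ := hh.exists_approx hτ₀ u hw
      refine ⟨Prod.map (fun x : ℝ => (x : UnitAddCircle)) (fun x : ℝ => (x : UnitAddCircle)) ''
        Metric.ball (u, u) r, ?_, ?_⟩
      · have := image_coe_mem_nhds (Metric.ball_mem_nhds (u, u) hr)
        rwa [← hne]
      · filter_upwards [hev, self_mem_nhdsWithin] with τ hτ hτI
        rintro _ ⟨p, hp, rfl⟩ hz
        obtain ⟨hz1, hz2⟩ := (coe_mem_crossings (hh.regular τ hτI).periodic).1 hz
        rw [← ball_prod_same] at hp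
        have h1 := hτ p.1 hp.1 p.2 hp.2
        rw [hz2, sub_self, zero_sub, norm_neg, norm_smul, Real.norm_eq_abs] at h1
        have h2 : p.1 ≠ p.2 := fun h => hz1 (by rw [h])
        have h3 : 0 < |p.1 - p.2| := abs_pos.2 (sub_ne_zero.2 h2)
        nlinarith
    · have hval : h τ₀ u ≠ h τ₀ v := fun h' => hxy ⟨u, v, rfl, hne, h'⟩
      obtain ⟨V, V', hV, hV', hVV⟩ := t2_separation_nhds hval
      obtain ⟨pa, ha, pb, hb, hab⟩ := Filter.eventually_prod_iff.1 (hh.tendsto hτ₀ u hV)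
      obtain ⟨qa, hqa, qb, hqb, hqab⟩ := Filter.eventually_prod_iff.1 (hh.tendsto hτ₀ v hV')
      refine ⟨_, image_coe_mem_nhds (prod_mem_nhds hb hqb), ?_⟩
      filter_upwards [ha, hqa, self_mem_nhdsWithin] with τ hτ hτ' hτI
      rintro _ ⟨p, hp, rfl⟩ hz
      have hz2 := ((coe_mem_crossings (hh.regular τ hτI).periodic).1 hz).2
      refine Set.disjoint_left.1 hVV (hab hτ hp.1) ?_
      have := hqab hτ' hp.2
      simp only at this ⊢
      rwa [hz2]

theorem IsRegularHomotopy.ncard_crossings_eq {h : ℝ → ℝ → ℂ} (hh : IsRegularHomotopy h)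
    (hg : ∀ τ ∈ Icc (0 : ℝ) 1, IsGeneric (h τ)) :
    (crossings (h 0)).ncard = (crossings (h 1)).ncard := by
  refine isPreconnected_Icc.constant (s := Icc (0 : ℝ) 1)
    (f := fun τ => (crossings (h τ)).ncard) ?_ (by simp) (by simp)
  intro τ hτ
  exact (tendsto_const_nhds (x := (crossings (h τ)).ncard)).congr'
    ((hh.eventually_ncard_crossings_eq hτ (hg τ hτ)).mono fun _ h' => h'.symm)

theorem IsCompartment.ncard_crossings_eq {jp jm s ω : ℤ} {C : Set (ℝ → ℂ)}
    (hC : IsCompartment jp jm s ω C) {γ β : ℝ → ℂ} (hγ : γ ∈ C) (hβ : β ∈ C) :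
    (crossings γ).ncard = (crossings β).ncard := by
  obtain ⟨γ₀, -, rfl⟩ := hC
  obtain ⟨h, hh, hg, h0, rfl⟩ := hγ
  obtain ⟨h', hh', hg', h0', rfl⟩ := hβ
  rw [← hh.ncard_crossings_eq fun τ hτ => (hg τ hτ).1,
    ← hh'.ncard_crossings_eq fun τ hτ => (hg' τ hτ).1, h0, h0']

/-! ### The energy of two crossing lines -/

/-- The square annulus `{δ' ≤ max |a| |b| < δ}`. -/
def squareAnnulus (δ' δ : ℝ) : Set (ℝ × ℝ) :=
  {z | δ' ≤ max |z.1| |z.2| ∧ max |z.1| |z.2| < δ}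

/-- The integrand of the tangent-point energy for two straight lines that cross at an angle with
sine `s` and cosine `c`. -/
def lineDensity (q s c : ℝ) (z : ℝ × ℝ) : ℝ≥0∞ :=
  ENNReal.ofReal ((2 * (|z.1| * s) / (z.1 ^ 2 + z.2 ^ 2 - 2 * (z.1 * z.2 * c))) ^ q)

/-- The contribution of a square annulus to the energy of two crossing lines. -/
def lineEnergy (q s c δ' δ : ℝ) : ℝ≥0∞ :=
  ∫⁻ z in squareAnnulus δ' δ, lineDensity q s c z

theorem measurableSet_squareAnnulus (δ' δ : ℝ) : MeasurableSet (squareAnnulus δ' δ) := by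
  have h : Measurable fun z : ℝ × ℝ => max |z.1| |z.2| := by fun_prop
  exact (measurableSet_le measurable_const h).inter (measurableSet_lt h measurable_const)

theorem measurable_lineDensity (q s c : ℝ) : Measurable (lineDensity q s c) := by
  unfold lineDensity
  fun_prop

theorem lintegral_comp_affine (g : ℝ → ℝ≥0∞) (hg : Measurable g) {A : ℝ} (hA : A ≠ 0) (B : ℝ) :
    ∫⁻ b, g b = ENNReal.ofReal |A| * ∫⁻ y, g (B + A * y) := by
  have h1 : ∫⁻ b, g b = ∫⁻ b, g (B + b) := (lintegral_add_left_eq_self g B).symm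
  have hg' : Measurable fun b => g (B + b) := by fun_prop
  rw [h1]
  conv_lhs => rw [← Real.smul_map_volume_mul_left hA]
  rw [lintegral_smul_measure, lintegral_map hg' (by fun_prop), smul_eq_mul]

/-- The angular factor of the energy of two crossing lines. -/
def lineWeight (q s c y : ℝ) : ℝ :=
  s / max 1 |c + s * y| ^ 2 * (2 * max 1 |c + s * y| / (s * (1 + y ^ 2))) ^ q

theorem measurable_lineWeight (q s c : ℝ) : Measurable (lineWeight q s c) := by
  unfold lineWeight
  fun_prop

/-- The substitution `b = a (c + s y)` turns the squared distance of the two points into `a² s² (1 +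
y²)`, and the max-norm of `(a, b)` into `|a| max 1 |c + s y|`. Rescaling `a` by this maximum
separates the variables. Only the `y`-integral depends on the angle. -/
theorem lineEnergy_eq {q s c : ℝ} (hs : 0 < s) (hsc : c ^ 2 + s ^ 2 = 1) {δ' δ : ℝ}
    (hδ' : 0 < δ') :
    lineEnergy q s c δ' δ = (∫⁻ y, ENNReal.ofReal (lineWeight q s c y)) *
      ∫⁻ a, {a : ℝ | δ' ≤ |a| ∧ |a| < δ}.indicator (fun a => ENNReal.ofReal (|a| * |a| ^ (-q))) a := by
  set F : ℝ × ℝ → ℝ≥0∞ := (squareAnnulus δ' δ).indicator (lineDensity q s c) with hF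
  have hFm : Measurable F := (measurable_lineDensity q s c).indicator
    (measurableSet_squareAnnulus δ' δ)
  set D : Set ℝ := {a : ℝ | δ' ≤ |a| ∧ |a| < δ} with hD
  have hDm : MeasurableSet D :=
    (measurableSet_le measurable_const measurable_id.abs).inter
      (measurableSet_lt measurable_id.abs measurable_const)
  set G : ℝ → ℝ≥0∞ := D.indicator (fun a => ENNReal.ofReal (|a| * |a| ^ (-q))) with hG
  have hGm : Measurable G := by
    refine Measurable.indicator ?_ hDm
    fun_prop
  have h0 : lineEnergy q s c δ' δ = ∫⁻ a, ∫⁻ b, F (a, b) := by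
    rw [lineEnergy, ← lintegral_indicator (measurableSet_squareAnnulus δ' δ),
      Measure.volume_eq_prod, lintegral_prod _ hFm.aemeasurable]
  have h1 : ∀ a : ℝ, a ≠ 0 → ∫⁻ b, F (a, b) =
      ∫⁻ y, ENNReal.ofReal (|a| * s) * F (a, a * c + a * s * y) := by
    intro a ha
    rw [lintegral_comp_affine (fun b => F (a, b)) (by fun_prop)
      (mul_ne_zero ha hs.ne') (a * c), abs_mul, abs_of_pos hs, ← lintegral_const_mul _ (by fun_prop)]
  have h2 : ∀ᵐ a : ℝ, a ≠ 0 := by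
    simp [ae_iff]
  rw [h0, lintegral_congr_ae (h2.mono h1), lintegral_lintegral_swap
    (Measurable.aemeasurable (by fun_prop)), ← lintegral_mul_const _
    (measurable_lineWeight q s c).ennreal_ofReal]
  refine lintegral_congr fun y => ?_
  set M := max 1 |c + s * y| with hM
  have hM0 : 0 < M := lt_of_lt_of_le one_pos (le_max_left _ _)
  rw [lintegral_comp_affine _ (by fun_prop) (inv_ne_zero hM0.ne') 0,
    ← lintegral_const_mul _ (by fun_prop), ← lintegral_const_mul _ hGm]
  refine lintegral_congr fun a => ?_
  have hz : max |0 + M⁻¹ * a| |(0 + M⁻¹ * a) * c + (0 + M⁻¹ * a) * s * y| = |a| := by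
    have e : (0 + M⁻¹ * a) * c + (0 + M⁻¹ * a) * s * y = (0 + M⁻¹ * a) * (c + s * y) := by ring
    have e' : ∀ t : ℝ, 0 ≤ t → max t (t * |c + s * y|) = t * M := fun t ht => by
      rw [hM, mul_max_of_nonneg _ _ ht, mul_one]
    rw [e, abs_mul (0 + M⁻¹ * a), e' _ (abs_nonneg _), zero_add, abs_mul, abs_inv,
      abs_of_pos hM0]
    field_simp
  by_cases ha : a ∈ D
  · have hmem : (0 + M⁻¹ * a, (0 + M⁻¹ * a) * c + (0 + M⁻¹ * a) * s * y) ∈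
        squareAnnulus δ' δ := by
      simp only [squareAnnulus, mem_ofPred_eq, hz]
      exact ha
    have ha0 : 0 < |a| := hδ'.trans_le ha.1
    rw [hF, hG, indicator_of_mem hmem, indicator_of_mem ha, lineDensity,
      ← ENNReal.ofReal_mul (by positivity), ← ENNReal.ofReal_mul (by positivity),
      ← ENNReal.ofReal_mul (by unfold lineWeight; positivity)]
    congr 1
    simp only [lineWeight, ← hM]
    have hden : (0 + M⁻¹ * a) ^ 2 + ((0 + M⁻¹ * a) * c + (0 + M⁻¹ * a) * s * y) ^ 2 -
        2 * ((0 + M⁻¹ * a) * ((0 + M⁻¹ * a) * c + (0 + M⁻¹ * a) * s * y) * c) =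
        (M⁻¹ * |a|) ^ 2 * (s ^ 2 * (1 + y ^ 2)) := by
      rw [mul_pow M⁻¹, sq_abs]
      have : c ^ 2 = 1 - s ^ 2 := by linarith
      ring_nf
      rw [this]
      ring
    rw [hden]
    have hab : |0 + M⁻¹ * a| = M⁻¹ * |a| := by
      rw [zero_add, abs_mul, abs_inv, abs_of_pos hM0]
    rw [hab, abs_inv, abs_of_pos hM0]
    have hfrac : 2 * (M⁻¹ * |a| * s) / ((M⁻¹ * |a|) ^ 2 * (s ^ 2 * (1 + y ^ 2))) =
        2 * M / (s * (1 + y ^ 2)) * |a|⁻¹ := by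
      have : 0 < 1 + y ^ 2 := by positivity
      field_simp
    rw [hfrac, Real.mul_rpow (by positivity) (by positivity), Real.inv_rpow ha0.le,
      ← Real.rpow_neg ha0.le]
    field_simp
  · have hmem : (0 + M⁻¹ * a, (0 + M⁻¹ * a) * c + (0 + M⁻¹ * a) * s * y) ∉
        squareAnnulus δ' δ := by
      simp only [squareAnnulus, mem_ofPred_eq, hz]
      exact ha
    rw [hF, hG, indicator_of_notMem hmem, indicator_of_notMem ha]
    simp

/-- The angular inequality, with `t = 1 / s` and `k = c / s` in the application. For `p ≥ 1` it
follows from convexity and `2|y| ≤ |k + y| + |k - y|`. For `p ≤ 1` convexity fails and the factor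
`t` must help: `y² ≤ t² m n`, `t ^ p ≤ t` and the arithmetic-geometric mean inequality suffice. -/
theorem two_mul_rpow_le_sum {p t k y : ℝ} (hp : 0 < p) (ht : 1 ≤ t) (htk : t ^ 2 = 1 + k ^ 2) :
    2 * max 1 |y| ^ p ≤ t * (max t |k + y| ^ p + max t |k - y| ^ p) := by
  set m := max t |k + y| with hm
  set n := max t |k - y| with hn
  have ht0 : 0 < t := by linarith
  have hmt : t ≤ m := le_max_left _ _
  have hnt : t ≤ n := le_max_left _ _
  have hm0 : 0 < m := by linarith
  have hn0 : 0 < n := by linarith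
  have hmp : 0 ≤ m ^ p := by positivity
  have hnp : 0 ≤ n ^ p := by positivity
  rcases le_total |y| 1 with hy | hy
  · rw [max_eq_left hy, Real.one_rpow]
    have h1 : 1 ≤ m ^ p := Real.one_le_rpow (by linarith) hp.le
    have h2 : 1 ≤ n ^ p := Real.one_le_rpow (by linarith) hp.le
    nlinarith
  rw [max_eq_right hy]
  rcases le_total 1 p with hp1 | hp1
  · have hcx := (convexOn_rpow hp1).2
    have h1 := hcx (mem_Ici.2 hm0.le) (mem_Ici.2 hn0.le)
      (by norm_num : (0 : ℝ) ≤ 1 / 2) (by norm_num : (0 : ℝ) ≤ 1 / 2) (by norm_num)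
    simp only [smul_eq_mul] at h1
    have h2 : |y| ≤ 1 / 2 * m + 1 / 2 * n := by
      have e1 : |k + y| ≤ m := le_max_right _ _
      have e2 : |k - y| ≤ n := le_max_right _ _
      have e3 : |(k + y) - (k - y)| ≤ |k + y| + |k - y| := abs_sub _ _
      have e4 : (k + y) - (k - y) = 2 * y := by ring
      rw [e4, abs_mul, abs_two] at e3
      linarith
    have h3 := Real.rpow_le_rpow (abs_nonneg y) h2 hp.le
    nlinarith
  · have key : y ^ 2 ≤ t ^ 2 * (m * n) := by
      rcases le_total (t ^ 2) (y ^ 2) with h | h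
      · have e1 : |k + y| ≤ m := le_max_right _ _
        have e2 : |k - y| ≤ n := le_max_right _ _
        have e3 : |k + y| * |k - y| ≤ m * n := by gcongr
        rw [← abs_mul] at e3
        have e4 : y ^ 2 - k ^ 2 ≤ |(k + y) * (k - y)| := by
          have := neg_abs_le ((k + y) * (k - y))
          nlinarith
        have e5 : t ^ 2 * (y ^ 2 - k ^ 2) ≤ t ^ 2 * (m * n) :=
          mul_le_mul_of_nonneg_left (e4.trans e3) (by positivity)
        -- The last term is nonnegative precisely in the present case `t² ≤ y²`.
        have e6 : t ^ 2 * (y ^ 2 - k ^ 2) = y ^ 2 + k ^ 2 * (y ^ 2 - t ^ 2) := by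
          rw [htk]; ring
        nlinarith [sq_nonneg k, mul_nonneg (sq_nonneg k) (sub_nonneg.2 h)]
      · have e1 : t * t ≤ m * n := by gcongr
        nlinarith [mul_pos hm0 hn0]
    have h1 : |y| ^ p ≤ t * (m * n) ^ (p / 2) := by
      calc |y| ^ p = (y ^ 2) ^ (p / 2) := by
            rw [← sq_abs, ← Real.rpow_natCast, ← Real.rpow_mul (abs_nonneg y)]
            congr 1
            push_cast
            ring
        _ ≤ (t ^ 2 * (m * n)) ^ (p / 2) := by gcongr
        _ = t ^ p * (m * n) ^ (p / 2) := by
            rw [Real.mul_rpow (by positivity) (by positivity), ← Real.rpow_natCast,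
              ← Real.rpow_mul ht0.le]
            congr 2
            push_cast
            ring
        _ ≤ t * (m * n) ^ (p / 2) := by
            gcongr
            calc t ^ p ≤ t ^ (1 : ℝ) := Real.rpow_le_rpow_of_exponent_le ht hp1
              _ = t := Real.rpow_one t
    have h2 : 2 * (m * n) ^ (p / 2) ≤ m ^ p + n ^ p := by
      rw [Real.mul_rpow hm0.le hn0.le]
      have e : ∀ x : ℝ, 0 < x → x ^ p = (x ^ (p / 2)) ^ 2 := fun x hx => by
        rw [← Real.rpow_natCast, ← Real.rpow_mul hx.le]
        congr 1
        push_cast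
        ring
      rw [e m hm0, e n hn0]
      nlinarith [sq_nonneg (m ^ (p / 2) - n ^ (p / 2))]
    nlinarith

/-- Pulling `s` out of the maximum isolates the exponent `q - 2`; this is where `q > 2` will be
used. -/
theorem lineWeight_eq {q s c : ℝ} (hs : 0 < s) (y : ℝ) :
    lineWeight q s c y = (2 / (1 + y ^ 2)) ^ q * (1 / s * max (1 / s) |c / s + y| ^ (q - 2)) := by
  have hmax : max 1 |c + s * y| = s * max (1 / s) |c / s + y| := by
    rw [mul_max_of_nonneg _ _ hs.le, mul_one_div_cancel hs.ne']
    congr 1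
    rw [← abs_of_pos hs, ← abs_mul, abs_of_pos hs]
    congr 1
    field_simp
  have hm : 0 < max (1 / s) |c / s + y| := lt_of_lt_of_le (by positivity) (le_max_left _ _)
  rw [lineWeight, hmax]
  generalize max (1 / s) |c / s + y| = m at hm
  have h1 : 2 * (s * m) / (s * (1 + y ^ 2)) = 2 / (1 + y ^ 2) * m := by
    have : 0 < 1 + y ^ 2 := by positivity
    field_simp
  rw [h1, Real.mul_rpow (by positivity) hm.le, Real.rpow_sub hm, Real.rpow_two]
  field_simp

/-- The comparison with the right angle is made after averaging over `y` and `-y`, which does not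
affect the integral. -/
theorem two_mul_lineWeight_le {q s c : ℝ} (hq : 2 < q) (hs : 0 < s) (hsc : c ^ 2 + s ^ 2 = 1)
    (y : ℝ) : 2 * lineWeight q 1 0 y ≤ lineWeight q s c y + lineWeight q s c (-y) := by
  have hs1 : s ≤ 1 := by nlinarith [sq_nonneg c]
  have h := two_mul_rpow_le_sum (p := q - 2) (t := 1 / s) (k := c / s) (y := y) (by linarith)
    (by rw [le_div_iff₀ hs]; linarith) (by field_simp; linarith)
  rw [lineWeight_eq one_pos, lineWeight_eq hs, lineWeight_eq hs, neg_sq, ← sub_eq_add_neg,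
    ← mul_add, ← mul_add]
  simp only [div_one, zero_add, one_mul]
  have h2 : 0 ≤ (2 / (1 + y ^ 2)) ^ q := by positivity
  nlinarith [mul_le_mul_of_nonneg_left h h2]

/-- Among all crossing angles, the right angle has the least energy. -/
theorem lineEnergy_right_angle_le {q s c : ℝ} (hq : 2 < q) (hs : 0 < s) (hsc : c ^ 2 + s ^ 2 = 1)
    {δ' δ : ℝ} (hδ' : 0 < δ') : lineEnergy q 1 0 δ' δ ≤ lineEnergy q s c δ' δ := by
  rw [lineEnergy_eq hs hsc hδ', lineEnergy_eq one_pos (by norm_num) hδ']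
  gcongr ?_ * _
  set I := ∫⁻ y, ENNReal.ofReal (lineWeight q s c y) with hI
  have hnn : ∀ y, 0 ≤ lineWeight q s c y := fun y => by unfold lineWeight; positivity
  have hneg : ∫⁻ y, ENNReal.ofReal (lineWeight q s c (-y)) = I :=
    lintegral_neg_eq_self (fun y => ENNReal.ofReal (lineWeight q s c y))
  have hm := (measurable_lineWeight q s c).ennreal_ofReal
  have h : 2 * ∫⁻ y, ENNReal.ofReal (lineWeight q 1 0 y) ≤ 2 * I := by
    rw [two_mul I]
    -- One of the two copies of the integral is reflected, so that the symmetrized pointwise bound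
    -- applies.
    nth_rewrite 2 [← hneg]
    rw [hI, ← lintegral_add_left hm, ← lintegral_const_mul _
      (measurable_lineWeight q 1 0).ennreal_ofReal]
    refine lintegral_mono fun y => ?_
    simp only
    rw [← ENNReal.ofReal_add (hnn _) (hnn _), show (2 : ℝ≥0∞) = ENNReal.ofReal 2 by simp,
      ← ENNReal.ofReal_mul (by norm_num)]
    exact ENNReal.ofReal_le_ofReal (two_mul_lineWeight_le hq hs hsc y)
  exact (ENNReal.mul_le_mul_iff_right (by norm_num) (by norm_num)).1 h

/-- On the annulus the density is at most `(2 / δ₀) ^ q`, and the area is the difference of two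
squares. This gives both finiteness and the limit as `δ'` increases to `δ`. -/
theorem lineEnergy_right_angle_le_ofReal {q : ℝ} (hq : 2 < q) {δ₀ δ' δ : ℝ} (hδ₀ : 0 < δ₀)
    (h : δ₀ ≤ δ') (hδ : δ' ≤ δ) :
    lineEnergy q 1 0 δ' δ ≤ ENNReal.ofReal ((2 / δ₀) ^ q * (4 * δ ^ 2 - 4 * δ' ^ 2)) := by
  have hvol : volume (squareAnnulus δ' δ) ≤ ENNReal.ofReal (4 * δ ^ 2 - 4 * δ' ^ 2) := by
    have hsub : squareAnnulus δ' δ ⊆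
        (Ioo (-δ) δ ×ˢ Ioo (-δ) δ) \ (Ioo (-δ') δ' ×ˢ Ioo (-δ') δ') := by
      rintro z ⟨h1, h2⟩
      obtain ⟨h3, h4⟩ := max_lt_iff.1 h2
      refine ⟨⟨abs_lt.1 h3, abs_lt.1 h4⟩, fun hz => h1.not_gt ?_⟩
      exact max_lt (abs_lt.2 hz.1) (abs_lt.2 hz.2)
    have hvolsq : ∀ r : ℝ, 0 ≤ r → volume (Ioo (-r) r ×ˢ Ioo (-r) r) =
        ENNReal.ofReal (4 * r ^ 2) := fun r hr => by
      rw [Measure.volume_eq_prod, Measure.prod_prod, Real.volume_Ioo,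
        ← ENNReal.ofReal_mul (by linarith)]
      congr 1
      ring
    refine (measure_mono hsub).trans_eq ?_
    rw [measure_sdiff (by
      apply Set.prod_mono <;> exact Ioo_subset_Ioo (by linarith) hδ)
      (measurableSet_Ioo.prod measurableSet_Ioo).nullMeasurableSet
      (by rw [hvolsq _ (by linarith)]; exact ENNReal.ofReal_ne_top),
      hvolsq _ (by linarith), hvolsq _ (by linarith), ← ENNReal.ofReal_sub _ (by positivity)]
  have hbound : ∀ z ∈ squareAnnulus δ' δ, lineDensity q 1 0 z ≤ ENNReal.ofReal ((2 / δ₀) ^ q) := by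
    rintro z ⟨h1, -⟩
    refine ENNReal.ofReal_le_ofReal ?_
    have hpos : 0 < max |z.1| |z.2| := by linarith
    have hsq : max |z.1| |z.2| ^ 2 ≤ z.1 ^ 2 + z.2 ^ 2 := by
      rcases max_cases |z.1| |z.2| with h | h <;> rw [h.1, sq_abs] <;> nlinarith
    have hle : |z.1| ≤ max |z.1| |z.2| := le_max_left _ _
    simp only [mul_one, mul_zero, sub_zero]
    refine Real.rpow_le_rpow (by positivity) ?_ (by linarith)
    rw [div_le_div_iff₀ (by nlinarith) hδ₀]
    have e1 : |z.1| * δ₀ ≤ max |z.1| |z.2| * max |z.1| |z.2| := by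
      gcongr
      linarith
    nlinarith
  have hnn : 0 ≤ (2 / δ₀) ^ q := by positivity
  calc lineEnergy q 1 0 δ' δ
      ≤ ∫⁻ _ in squareAnnulus δ' δ, ENNReal.ofReal ((2 / δ₀) ^ q) :=
        setLIntegral_mono measurable_const hbound
    _ = ENNReal.ofReal ((2 / δ₀) ^ q) * volume (squareAnnulus δ' δ) := setLIntegral_const _ _
    _ ≤ ENNReal.ofReal ((2 / δ₀) ^ q) * ENNReal.ofReal (4 * δ ^ 2 - 4 * δ' ^ 2) := by gcongr
    _ = _ := (ENNReal.ofReal_mul hnn).symm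

theorem lineEnergy_right_angle_ne_top {q : ℝ} (hq : 2 < q) {δ' δ : ℝ} (hδ' : 0 < δ')
    (hδ : δ' ≤ δ) : lineEnergy q 1 0 δ' δ ≠ ∞ :=
  ne_top_of_le_ne_top ENNReal.ofReal_ne_top (lineEnergy_right_angle_le_ofReal hq hδ' le_rfl hδ)

theorem tendsto_lineEnergy_right_angle {q : ℝ} (hq : 2 < q) {δ : ℝ} (hδ : 0 < δ) :
    Tendsto (fun δ' => lineEnergy q 1 0 δ' δ) (𝓝[<] δ) (𝓝 0) := by
  have h1 : Tendsto (fun δ' => ENNReal.ofReal ((2 / (δ / 2)) ^ q * (4 * δ ^ 2 - 4 * δ' ^ 2)))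
      (𝓝[<] δ) (𝓝 0) := by
    have hc : Continuous fun δ' : ℝ =>
        ENNReal.ofReal ((2 / (δ / 2)) ^ q * (4 * δ ^ 2 - 4 * δ' ^ 2)) :=
      ENNReal.continuous_ofReal.comp (by fun_prop)
    have := (hc.tendsto δ).mono_left (nhdsWithin_le_nhds (s := Iio δ))
    simpa using this
  refine tendsto_of_tendsto_of_tendsto_of_le_of_le' tendsto_const_nhds h1
    (Eventually.of_forall fun _ => zero_le) ?_
  filter_upwards [Ioo_mem_nhdsLT (show δ / 2 < δ by linarith)] with δ' hδ'
  exact lineEnergy_right_angle_le_ofReal hq (by positivity) hδ'.1.le hδ'.2.le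

/-! ### Splitting the energy of an admissible curve -/

theorem setLIntegral_Ico_eq_of_periodic {g : ℝ → ℝ≥0∞} (hg : Function.Periodic g 1) (s t : ℝ) :
    ∫⁻ x in Ico s (s + 1), g x = ∫⁻ x in Ico t (t + 1), g x := by
  rw [setLIntegral_congr (Ico_ae_eq_Ioc (a := s)), setLIntegral_congr (Ico_ae_eq_Ioc (a := t))]
  exact IsAddFundamentalDomain.setLIntegral_eq (isAddFundamentalDomain_Ioc one_pos s)
    (isAddFundamentalDomain_Ioc one_pos t) g hg.map_vadd_zmultiples

/-- Allows the fundamental square to be centred at a crossing, where its boundary does not cut the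
annulus. -/
theorem setLIntegral_square_eq_of_periodic {F : ℝ × ℝ → ℝ≥0∞} (hF : Measurable F)
    (h1 : ∀ y, Function.Periodic (fun x => F (x, y)) 1)
    (h2 : ∀ x, Function.Periodic (fun y => F (x, y)) 1) (s t s' t' : ℝ) :
    ∫⁻ z in Ico s (s + 1) ×ˢ Ico t (t + 1), F z =
      ∫⁻ z in Ico s' (s' + 1) ×ˢ Ico t' (t' + 1), F z := by
  have h : ∀ s t : ℝ, ∫⁻ z in Ico s (s + 1) ×ˢ Ico t (t + 1), F z =
      ∫⁻ x in Ico s (s + 1), ∫⁻ y in Ico t (t + 1), F (x, y) := fun s t => by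
    rw [Measure.volume_eq_prod, setLIntegral_prod _ hF.aemeasurable]
  rw [h, h]
  have h3 : ∀ x, ∫⁻ y in Ico t (t + 1), F (x, y) = ∫⁻ y in Ico t' (t' + 1), F (x, y) := fun x =>
    setLIntegral_Ico_eq_of_periodic (h2 x) t t'
  simp only [h3]
  refine setLIntegral_Ico_eq_of_periodic (g := fun x => ∫⁻ y in Ico t' (t' + 1), F (x, y)) ?_ s s'
  intro x
  exact lintegral_congr fun y => h1 y x

theorem IsGeneric.snd_eq_of_crossings {γ : ℝ → ℂ} (hγ : IsGeneric γ) {u v w : ℝ}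
    (hv : (u : UnitAddCircle) ≠ v) (hw : (u : UnitAddCircle) ≠ w) (huv : γ u = γ v)
    (huw : γ u = γ w) : (v : UnitAddCircle) = w := by
  obtain ⟨t, ht, htw⟩ := exists_mem_Ico_coe_eq w
  have hγt : γ t = γ u := by rw [apply_eq_of_coe_eq hγ.periodic htw, huw]
  obtain ⟨p, hp, h | h⟩ := exists_selfInt_of_crossing hγ.periodic hv huv
  · rcases hγ.double p hp t ht (by rw [hγt, apply_eq_of_coe_eq hγ.periodic h.1]) with h' | h'
    · exact absurd (by rw [← htw, h', h.1]) hw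
    · rw [← htw, h', h.2]
  · rcases hγ.double p hp t ht
      (by rw [hγt, apply_eq_of_coe_eq hγ.periodic h.2, huv] at *) with h' | h'
    · rw [← htw, h', h.2]
    · exact absurd (by rw [← htw, h', h.1]) hw

theorem exists_mem_intParams_of_crossing {γ : ℝ → ℂ} (hγ : Function.Periodic γ 1) {u v : ℝ}
    (hne : (u : UnitAddCircle) ≠ v) (heq : γ u = γ v) :
    ∃ t ∈ intParams γ, (t : UnitAddCircle) = u := by
  obtain ⟨p, hp, h | h⟩ := exists_selfInt_of_crossing hγ hne heq
  · exact ⟨p.1, ⟨p, hp, Or.inl rfl⟩, h.1⟩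
  · exact ⟨p.2, ⟨p, hp, Or.inr rfl⟩, h.1⟩

/-! ### Admissible curves: separated, straight crossings and the resulting energy decomposition -/

section Admissible

variable {η : ℝ} {jp jm s ω : ℤ} {γ : ℝ → ℂ}

theorem isGeneric_of_mem_admissible (hγ : γ ∈ admissible η jp jm s ω) : IsGeneric γ := hγ.1.1

theorem norm_deriv_of_mem_admissible (hγ : γ ∈ admissible η jp jm s ω) (t : ℝ) :
    ‖deriv γ t‖ = 1 := hγ.2.1 t

theorem le_norm_sub_of_mem_intParams (hγ : γ ∈ admissible η jp jm s ω) {a b : ℝ}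
    (ha : a ∈ intParams γ) (hb : b ∈ intParams γ) (hab : (a : UnitAddCircle) ≠ b) :
    2 * η ≤ ‖(a : UnitAddCircle) - b‖ := by
  have h1 := hγ.2.2.1
  have hne : a ≠ b := fun h => hab (by rw [h])
  have h2 : minArcDist γ ≤ ENNReal.ofReal (arcDist γ a b) :=
    (iInf₂_le a ha).trans ((iInf₂_le b hb).trans (iInf_le _ hne))
  have h3 := h1.trans h2
  rw [arcDist_eq_norm hγ.2.1, AddCircle.coe_sub] at h3
  exact (ENNReal.ofReal_le_ofReal_iff (norm_nonneg _)).1 h3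

theorem le_norm_fst_sub_snd (hγ : γ ∈ admissible η jp jm s ω) {P : UnitAddCircle × UnitAddCircle}
    (hP : P ∈ crossings γ) : 2 * η ≤ ‖P.1 - P.2‖ := by
  obtain ⟨u, v, rfl, hne, heq⟩ := hP
  have hper := (isGeneric_of_mem_admissible hγ).periodic
  obtain ⟨a, ha, hau⟩ := exists_mem_intParams_of_crossing hper hne heq
  obtain ⟨b, hb, hbv⟩ := exists_mem_intParams_of_crossing hper hne.symm heq.symm
  have := le_norm_sub_of_mem_intParams hγ ha hb (by rwa [hau, hbv])
  rwa [hau, hbv] at this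

/-- Distinct parameters in `T(γ)` are at least `2η` apart, so the first entries agree; the second
entry is then determined since all crossings are double. -/
theorem eq_of_norm_sub_lt (hγ : γ ∈ admissible η jp jm s ω)
    {P P' : UnitAddCircle × UnitAddCircle} (hP : P ∈ crossings γ) (hP' : P' ∈ crossings γ)
    (h : ‖P.1 - P'.1‖ < 2 * η) : P = P' := by
  obtain ⟨u, v, rfl, hne, heq⟩ := hP
  obtain ⟨u', v', rfl, hne', heq'⟩ := hP'
  have hg := isGeneric_of_mem_admissible hγ
  have hper := hg.periodic
  have h1 : (u : UnitAddCircle) = u' := by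
    by_contra hcon
    obtain ⟨a, ha, hau⟩ := exists_mem_intParams_of_crossing hper hne heq
    obtain ⟨b, hb, hbv⟩ := exists_mem_intParams_of_crossing hper hne' heq'
    have := le_norm_sub_of_mem_intParams hγ ha hb (by rwa [hau, hbv])
    rw [hau, hbv] at this
    exact h.not_ge this
  have h2 : (v : UnitAddCircle) = v' :=
    hg.snd_eq_of_crossings hne (by rwa [h1]) heq (by rw [apply_eq_of_coe_eq hper h1, heq'])
  rw [h1, h2]

theorem affine_near_crossing (hγ : γ ∈ admissible η jp jm s ω) (hη : 0 < η) {u v : ℝ}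
    (hne : (u : UnitAddCircle) ≠ v) (heq : γ u = γ v) {x : ℝ} (hx : |x| < η) :
    γ (u + x) = γ u + x • deriv γ u ∧ deriv γ (u + x) = deriv γ u := by
  have hper := (isGeneric_of_mem_admissible hγ).periodic
  obtain ⟨t, ht, htu⟩ := exists_mem_intParams_of_crossing hper hne heq
  have htu' : ∀ y : ℝ, ((u + y : ℝ) : UnitAddCircle) = (t + y : ℝ) := fun y => by
    rw [AddCircle.coe_add, AddCircle.coe_add, htu]
  obtain ⟨p, w, hpw⟩ := hγ.2.2.2 t ht
  have hmem : ∀ y : ℝ, |y| < η → t + y ∈ Ioo (t - η) (t + η) := fun y hy => by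
    obtain ⟨h1, h2⟩ := abs_lt.1 hy
    exact ⟨by linarith, by linarith⟩
  have hder : ∀ y : ℝ, |y| < η → deriv γ (u + y) = w := fun y hy => by
    rw [apply_eq_of_coe_eq (periodic_deriv hper) (htu' y)]
    have hev : γ =ᶠ[𝓝 (t + y)] fun x => p + x • w := by
      filter_upwards [isOpen_Ioo.mem_nhds (hmem y hy)] with x hx using hpw x hx
    rw [hev.deriv_eq]
    have : HasDerivAt (fun x : ℝ => p + x • w) ((1 : ℝ) • w) (t + y) :=
      ((hasDerivAt_id (t + y)).smul_const w).const_add p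
    rw [this.deriv, one_smul]
  have hu : deriv γ u = w := by simpa using hder 0 (by simpa using hη)
  have ht0 : γ u = p + t • w := by
    rw [← apply_eq_of_coe_eq hper htu]
    exact hpw t (by simpa using hmem 0 (by simpa using hη))
  refine ⟨?_, (hder x hx).trans hu.symm⟩
  rw [apply_eq_of_coe_eq hper (htu' x), hpw _ (hmem x hx), ht0, hu, add_smul, add_assoc]

/-- Both branches are straight here: the distance of `a v₁` from the line spanned by `v₂` is `|a|
|v₁ × v₂|`, and the denominator is given by the law of cosines. -/
theorem tpDensity_near_crossing (hγ : γ ∈ admissible η jp jm s ω) (hη : 0 < η) (q : ℝ) {u v : ℝ}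
    (hne : (u : UnitAddCircle) ≠ v) (heq : γ u = γ v) {a b : ℝ} (ha : |a| < η) (hb : |b| < η) :
    tpDensity q γ (u + a, v + b) =
      lineDensity q |cross (deriv γ u) (deriv γ v)| (dot (deriv γ u) (deriv γ v)) (a, b) := by
  obtain ⟨h1, h2⟩ := affine_near_crossing hγ hη hne heq ha
  obtain ⟨h3, h4⟩ := affine_near_crossing hγ hη hne.symm heq.symm hb
  have n1 := norm_deriv_of_mem_admissible hγ u
  have n2 := norm_deriv_of_mem_admissible hγ v
  simp only [tpDensity, lineDensity, h1, h3, h4, heq]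
  generalize deriv γ u = v₁ at *
  generalize deriv γ v = v₂ at *
  have hsq : ∀ z : ℂ, ‖z‖ = 1 → z.re ^ 2 + z.im ^ 2 = 1 := fun z hz => by
    have := Complex.sq_norm z
    rw [hz, Complex.normSq_apply] at this
    linarith
  have e1 := hsq _ n1
  have e2 := hsq _ n2
  have hc : |cross v₂ (γ v + a • v₁ - (γ v + b • v₂))| = |a| * |cross v₁ v₂| := by
    rw [← abs_mul, ← abs_neg]
    congr 1
    simp only [cross, Complex.sub_re, Complex.sub_im, Complex.add_re, Complex.add_im,
      Complex.real_smul, Complex.re_ofReal_mul, Complex.im_ofReal_mul]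
    ring
  have hn : ‖γ v + b • v₂ - (γ v + a • v₁)‖ ^ 2 = a ^ 2 + b ^ 2 - 2 * (a * b * dot v₁ v₂) := by
    rw [Complex.sq_norm, Complex.normSq_apply]
    simp only [dot, Complex.sub_re, Complex.sub_im, Complex.add_re, Complex.add_im,
      Complex.real_smul, Complex.re_ofReal_mul, Complex.im_ofReal_mul]
    linear_combination a ^ 2 * e1 + b ^ 2 * e2
  rw [hc, hn]

/-- The points at `ℓ^∞`-distance in `[δ', δ)` from the pair `P` on the torus. -/
def torusAnnulus (P : UnitAddCircle × UnitAddCircle) (δ' δ : ℝ) : Set (ℝ × ℝ) :=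
  {z | δ' ≤ max ‖(z.1 : UnitAddCircle) - P.1‖ ‖(z.2 : UnitAddCircle) - P.2‖ ∧
    max ‖(z.1 : UnitAddCircle) - P.1‖ ‖(z.2 : UnitAddCircle) - P.2‖ < δ}

theorem measurableSet_torusAnnulus (P : UnitAddCircle × UnitAddCircle) (δ' δ : ℝ) :
    MeasurableSet (torusAnnulus P δ' δ) := by
  have hc : Continuous (fun x : ℝ => (x : UnitAddCircle)) := AddCircle.continuous_mk' 1
  have h : Measurable fun z : ℝ × ℝ =>
      max ‖(z.1 : UnitAddCircle) - P.1‖ ‖(z.2 : UnitAddCircle) - P.2‖ :=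
    (((hc.comp continuous_fst).sub continuous_const).norm.max
      ((hc.comp continuous_snd).sub continuous_const).norm).measurable
  exact (measurableSet_le measurable_const h).inter (measurableSet_lt h measurable_const)

theorem setLIntegral_torusAnnulus (hγ : γ ∈ admissible η jp jm s ω) (hη : 0 < η) (q : ℝ)
    {δ' δ : ℝ} (hδ : δ ≤ η / 2) {u v : ℝ} (hne : (u : UnitAddCircle) ≠ v) (heq : γ u = γ v) :
    ∫⁻ z in (Ico (0 : ℝ) 1 ×ˢ Ico (0 : ℝ) 1) ∩
        torusAnnulus ((u : UnitAddCircle), (v : UnitAddCircle)) δ' δ, tpDensity q γ z =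
      lineEnergy q |cross (deriv γ u) (deriv γ v)| (dot (deriv γ u) (deriv γ v)) δ' δ := by
  have hg := isGeneric_of_mem_admissible hγ
  have hper := hg.periodic
  have hdper := periodic_deriv hper
  -- Two points of the circle are at most `1/2` apart, while crossing parameters are at least `2η`
  -- apart. Hence `δ < 1/2`, and the annulus fits into one period square.
  have hη' : η ≤ 1 / 4 := by
    have h1 := le_norm_fst_sub_snd hγ ⟨u, v, rfl, hne, heq⟩
    have h2 := AddCircle.norm_le_half_period (1 : ℝ) (x := (u : UnitAddCircle) - v) one_ne_zero
    rw [abs_one] at h2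
    simp only at h1
    linarith [h1.trans h2]
  set B := torusAnnulus ((u : UnitAddCircle), (v : UnitAddCircle)) δ' δ with hB
  set F : ℝ × ℝ → ℝ≥0∞ := B.indicator (tpDensity q γ) with hF
  have hBm : MeasurableSet B := measurableSet_torusAnnulus _ _ _
  have hFm : Measurable F := (measurable_tpDensity hg.contDiff q).indicator hBm
  have hcoe : ∀ x : ℝ, ((x + 1 : ℝ) : UnitAddCircle) = x := fun x => by
    simp
  have hB1 : ∀ x y : ℝ, (x + 1, y) ∈ B ↔ (x, y) ∈ B := fun x y => by
    simp only [hB, torusAnnulus, mem_ofPred_eq, hcoe]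
  have hB2 : ∀ x y : ℝ, (x, y + 1) ∈ B ↔ (x, y) ∈ B := fun x y => by
    simp only [hB, torusAnnulus, mem_ofPred_eq, hcoe]
  have hF1 : ∀ y, Function.Periodic (fun x => F (x, y)) 1 := fun y x => by
    have : tpDensity q γ (x + 1, y) = tpDensity q γ (x, y) := by
      simp only [tpDensity, hper x]
    by_cases hz : (x, y) ∈ B
    · simp only [hF]
      rw [indicator_of_mem hz, indicator_of_mem ((hB1 x y).2 hz), this]
    · simp only [hF]
      rw [indicator_of_notMem hz, indicator_of_notMem fun h => hz ((hB1 x y).1 h)]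
  have hF2 : ∀ x, Function.Periodic (fun y => F (x, y)) 1 := fun x y => by
    have : tpDensity q γ (x, y + 1) = tpDensity q γ (x, y) := by
      simp only [tpDensity, hper y, hdper y]
    by_cases hz : (x, y) ∈ B
    · simp only [hF]
      rw [indicator_of_mem hz, indicator_of_mem ((hB2 x y).2 hz), this]
    · simp only [hF]
      rw [indicator_of_notMem hz, indicator_of_notMem fun h => hz ((hB2 x y).1 h)]
  have hshift := setLIntegral_square_eq_of_periodic hFm hF1 hF2 0 0 (u - 1 / 2) (v - 1 / 2)
  rw [zero_add] at hshift
  rw [inter_comm, ← setLIntegral_indicator hBm, hshift, ← lintegral_indicator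
    (measurableSet_Ico.prod measurableSet_Ico), ← lintegral_add_left_eq_self _ (u, v), lineEnergy,
    ← lintegral_indicator (measurableSet_squareAnnulus δ' δ)]
  refine lintegral_congr fun z => ?_
  obtain ⟨a, b⟩ := z
  rw [Prod.mk_add_mk]
  have hB' : |a| ≤ 1 / 2 → |b| ≤ 1 / 2 → ((u + a, v + b) ∈ B ↔ (a, b) ∈ squareAnnulus δ' δ) := by
    intro ha hb
    have e : ∀ x t : ℝ, |x| ≤ 1 / 2 → ‖((t + x : ℝ) : UnitAddCircle) - t‖ = |x| := by
      intro x t hx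
      rw [AddCircle.coe_add, add_sub_cancel_left]
      exact (AddCircle.norm_coe_eq_abs_iff (1 : ℝ) one_ne_zero).2 (by simpa using hx)
    simp only [hB, torusAnnulus, squareAnnulus, mem_ofPred_eq, e a u ha, e b v hb]
  by_cases hz : (a, b) ∈ squareAnnulus δ' δ
  · obtain ⟨ha, hb⟩ := max_lt_iff.1 hz.2
    simp only at ha hb
    have ha' : |a| < 1 / 2 := by linarith
    have hb' : |b| < 1 / 2 := by linarith
    have hdom : (u + a, v + b) ∈
        Ico (u - 1 / 2) (u - 1 / 2 + 1) ×ˢ Ico (v - 1 / 2) (v - 1 / 2 + 1) := by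
      obtain ⟨a1, a2⟩ := abs_lt.1 ha'
      obtain ⟨b1, b2⟩ := abs_lt.1 hb'
      refine ⟨⟨?_, ?_⟩, ⟨?_, ?_⟩⟩ <;> simp only <;> linarith
    rw [indicator_of_mem hdom, indicator_of_mem hz, hF,
      indicator_of_mem ((hB' ha'.le hb'.le).2 hz)]
    exact tpDensity_near_crossing hγ hη q hne heq (by linarith) (by linarith)
  · rw [indicator_of_notMem hz]
    by_cases hdom : (u + a, v + b) ∈
        Ico (u - 1 / 2) (u - 1 / 2 + 1) ×ˢ Ico (v - 1 / 2) (v - 1 / 2 + 1)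
    · rw [indicator_of_mem hdom, hF, indicator_of_notMem]
      obtain ⟨⟨a1, a2⟩, ⟨b1, b2⟩⟩ := hdom
      simp only at a1 a2 b1 b2
      rwa [hB' (abs_le.2 ⟨by linarith, by linarith⟩) (abs_le.2 ⟨by linarith, by linarith⟩)]
    · rw [indicator_of_notMem hdom]

/-- The contribution to the energy of the part of the torus between the squares of radius `δ'` and
`δ` at a crossing. -/
def crossingEnergy (q δ' δ : ℝ) (γ : ℝ → ℂ) (P : UnitAddCircle × UnitAddCircle) : ℝ≥0∞ :=
  ∫⁻ z in (Ico (0 : ℝ) 1 ×ˢ Ico (0 : ℝ) 1) ∩ torusAnnulus P δ' δ, tpDensity q γ z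

/-- The square neighbourhoods of distinct crossings are disjoint, because a common point would bring
the first entries within `2δ ≤ η < 2η`. Thus passing from `δ` to `δ'` restores exactly one annulus
per ordered crossing. -/
theorem truncEnergy_eq_add_sum (hγ : γ ∈ admissible η jp jm s ω) (hη : 0 < η) (q : ℝ) {δ' δ : ℝ}
    (hδ' : δ' ≤ δ) (hδ : δ ≤ η / 2) :
    truncEnergy q δ' γ = truncEnergy q δ γ +
      ∑ P ∈ (finite_crossings (isGeneric_of_mem_admissible hγ).periodic
        (isGeneric_of_mem_admissible hγ).finite).toFinset, crossingEnergy q δ' δ γ P := by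
  have hg := isGeneric_of_mem_admissible hγ
  have hper := hg.periodic
  have hn := norm_deriv_of_mem_admissible hγ
  set Z := (finite_crossings hper hg.finite).toFinset with hZ
  set D : Set (ℝ × ℝ) := Ico (0 : ℝ) 1 ×ˢ Ico (0 : ℝ) 1 with hD
  have hDm : MeasurableSet D := measurableSet_Ico.prod measurableSet_Ico
  have hclose : ∀ P ∈ crossings γ, ∀ P' ∈ crossings γ, ∀ z : ℝ × ℝ,
      ‖(z.1 : UnitAddCircle) - P.1‖ < δ → ‖(z.1 : UnitAddCircle) - P'.1‖ < δ → P = P' := by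
    intro P hP P' hP' z h1 h2
    refine eq_of_norm_sub_lt hγ hP hP' ?_
    have h3 : P.1 - P'.1 = ((z.1 : UnitAddCircle) - P'.1) - ((z.1 : UnitAddCircle) - P.1) := by
      abel
    rw [h3]
    refine (norm_sub_le _ _).trans_lt ?_
    linarith
  have hunion : D \ truncSet γ δ' = (D \ truncSet γ δ) ∪ ⋃ P ∈ Z, D ∩ torusAnnulus P δ' δ := by
    ext z
    simp only [Set.mem_sdiff, mem_union, mem_iUnion, mem_inter_iff, mem_truncSet_iff hper hn, hZ,
      Finite.mem_toFinset, exists_prop]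
    constructor
    · rintro ⟨hzD, hz⟩
      by_cases h : ∃ P ∈ crossings γ, ‖(z.1 : UnitAddCircle) - P.1‖ < δ ∧
          ‖(z.2 : UnitAddCircle) - P.2‖ < δ
      · obtain ⟨P, hP, h1, h2⟩ := h
        refine Or.inr ⟨P, hP, hzD, ?_, max_lt h1 h2⟩
        by_contra! hcon
        exact hz ⟨P, hP, max_lt_iff.1 hcon⟩
      · exact Or.inl ⟨hzD, h⟩
    · rintro (⟨hzD, h⟩ | ⟨P, hP, hzD, h1, h2⟩)
      · exact ⟨hzD, fun ⟨P, hP, h1, h2⟩ => h ⟨P, hP, h1.trans_le hδ', h2.trans_le hδ'⟩⟩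
      · refine ⟨hzD, fun ⟨P', hP', h3, h4⟩ => ?_⟩
        obtain rfl := hclose P hP P' hP' z (max_lt_iff.1 h2).1 (h3.trans_le hδ')
        exact h1.not_gt (max_lt h3 h4)
  have hdisj : Disjoint (D \ truncSet γ δ) (⋃ P ∈ Z, D ∩ torusAnnulus P δ' δ) := by
    rw [Set.disjoint_left]
    intro z hz hz'
    obtain ⟨P, hP, -, h⟩ := mem_iUnion₂.1 hz'
    exact hz.2 ((mem_truncSet_iff hper hn).2
      ⟨P, (finite_crossings hper hg.finite).mem_toFinset.1 hP, max_lt_iff.1 h.2⟩)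
  have hmeas : ∀ P, MeasurableSet (D ∩ torusAnnulus P δ' δ) := fun P =>
    hDm.inter (measurableSet_torusAnnulus P δ' δ)
  rw [truncEnergy_eq hn, truncEnergy_eq hn, hunion,
    lintegral_union (Finset.measurableSet_biUnion _ fun P _ => hmeas P) hdisj,
    lintegral_biUnion_finset ?_ fun P _ => hmeas P]
  · rfl
  · intro P hP P' hP' hne
    refine Set.disjoint_left.2 fun z hz hz' => hne ?_
    exact hclose P ((finite_crossings hper hg.finite).mem_toFinset.1 hP) P'
      ((finite_crossings hper hg.finite).mem_toFinset.1 hP') z (max_lt_iff.1 hz.2.2).1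
      (max_lt_iff.1 hz'.2.2).1

theorem lineEnergy_right_angle_le_crossingEnergy (hγ : γ ∈ admissible η jp jm s ω) (hη : 0 < η)
    {q : ℝ} (hq : 2 < q) {δ' δ : ℝ} (hδ' : 0 < δ') (hδ : δ ≤ η / 2)
    {P : UnitAddCircle × UnitAddCircle} (hP : P ∈ crossings γ) :
    lineEnergy q 1 0 δ' δ ≤ crossingEnergy q δ' δ γ P := by
  obtain ⟨u, v, rfl, hne, heq⟩ := hP
  rw [crossingEnergy, setLIntegral_torusAnnulus hγ hη q hδ hne heq]
  refine lineEnergy_right_angle_le hq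
    (abs_pos.2 ((isGeneric_of_mem_admissible hγ).cross_ne_zero hne heq)) ?_ hδ'
  rw [sq_abs, dot_sq_add_cross_sq, norm_deriv_of_mem_admissible hγ,
    norm_deriv_of_mem_admissible hγ]
  norm_num

theorem dot_eq_zero_of_intersectionAngle {p : ℝ × ℝ} (h : intersectionAngle γ p = Real.pi / 2) :
    dot (deriv γ p.1) (deriv γ p.2) = 0 := by
  have h1 : InnerProductGeometry.angle (deriv γ p.1) (deriv γ p.2) = Real.pi / 2 := by
    rw [intersectionAngle] at h
    rcases min_choice (InnerProductGeometry.angle (deriv γ p.1) (deriv γ p.2))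
      (Real.pi - InnerProductGeometry.angle (deriv γ p.1) (deriv γ p.2)) with h' | h' <;>
    rw [h'] at h <;> linarith
  rw [← InnerProductGeometry.inner_eq_zero_iff_angle_eq_pi_div_two, Complex.inner] at h1
  simp only [Complex.mul_re, Complex.conj_re, Complex.conj_im] at h1
  rw [dot]
  linarith

theorem crossingEnergy_eq_of_right_angles (hγ : γ ∈ admissible η jp jm s ω) (hη : 0 < η) (q : ℝ)
    {δ' δ : ℝ} (hδ : δ ≤ η / 2)
    (hangle : ∀ p ∈ selfInt γ, intersectionAngle γ p = Real.pi / 2)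
    {P : UnitAddCircle × UnitAddCircle} (hP : P ∈ crossings γ) :
    crossingEnergy q δ' δ γ P = lineEnergy q 1 0 δ' δ := by
  obtain ⟨u, v, rfl, hne, heq⟩ := hP
  have hper := (isGeneric_of_mem_admissible hγ).periodic
  have hd := periodic_deriv hper
  have hdot : dot (deriv γ u) (deriv γ v) = 0 := by
    obtain ⟨p, hp, h | h⟩ := exists_selfInt_of_crossing hper hne heq
    · rw [← apply_eq_of_coe_eq hd h.1, ← apply_eq_of_coe_eq hd h.2]
      exact dot_eq_zero_of_intersectionAngle (hangle p hp)
    · rw [← apply_eq_of_coe_eq hd h.1, ← apply_eq_of_coe_eq hd h.2, dot_comm]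
      exact dot_eq_zero_of_intersectionAngle (hangle p hp)
  have hcross : |cross (deriv γ u) (deriv γ v)| = 1 := by
    have h := dot_sq_add_cross_sq (deriv γ u) (deriv γ v)
    rw [hdot, norm_deriv_of_mem_admissible hγ, norm_deriv_of_mem_admissible hγ] at h
    rw [← sq_eq_sq₀ (abs_nonneg _) zero_le_one, sq_abs]
    linarith
  rw [crossingEnergy, setLIntegral_torusAnnulus hγ hη q hδ hne heq, hdot, hcross]

theorem truncEnergy_eq_of_right_angles (hγ : γ ∈ admissible η jp jm s ω) (hη : 0 < η) (q : ℝ)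
    {δ' δ : ℝ} (hδ' : δ' ≤ δ) (hδ : δ ≤ η / 2)
    (hangle : ∀ p ∈ selfInt γ, intersectionAngle γ p = Real.pi / 2) :
    truncEnergy q δ' γ = truncEnergy q δ γ +
      (crossings γ).ncard * lineEnergy q 1 0 δ' δ := by
  have hfin := finite_crossings (isGeneric_of_mem_admissible hγ).periodic
    (isGeneric_of_mem_admissible hγ).finite
  rw [truncEnergy_eq_add_sum hγ hη q hδ' hδ, Finset.sum_congr rfl fun P hP =>
    crossingEnergy_eq_of_right_angles hγ hη q hδ hangle (hfin.mem_toFinset.1 hP),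
    Finset.sum_const, nsmul_eq_mul, ncard_eq_toFinset_card _ hfin]

theorem add_le_truncEnergy (hγ : γ ∈ admissible η jp jm s ω) (hη : 0 < η) {q : ℝ} (hq : 2 < q)
    {δ' δ : ℝ} (hδ'0 : 0 < δ') (hδ' : δ' ≤ δ) (hδ : δ ≤ η / 2) :
    truncEnergy q δ γ + (crossings γ).ncard * lineEnergy q 1 0 δ' δ ≤ truncEnergy q δ' γ := by
  have hfin := finite_crossings (isGeneric_of_mem_admissible hγ).periodic
    (isGeneric_of_mem_admissible hγ).finite
  rw [truncEnergy_eq_add_sum hγ hη q hδ' hδ, ncard_eq_toFinset_card _ hfin, ← nsmul_eq_mul]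
  gcongr
  exact Finset.card_nsmul_le_sum _ _ _ fun P hP =>
    lineEnergy_right_angle_le_crossingEnergy hγ hη hq hδ'0 hδ (hfin.mem_toFinset.1 hP)

end Admissible

/-! ### Lower semicontinuity of the energy and the limit of minimizers -/

theorem tendsto_tpDensity {q : ℝ} (hq : 0 < q) {γs : ℕ → ℝ → ℂ} {Γ : ℝ → ℂ} {z : ℝ × ℝ}
    (h0 : Γ z.1 ≠ Γ z.2)
    (h1 : Tendsto (fun k => γs k z.1 - γs k z.2) atTop (𝓝 (Γ z.1 - Γ z.2)))
    (h2 : Tendsto (fun k => deriv (γs k) z.2) atTop (𝓝 (deriv Γ z.2))) :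
    Tendsto (fun k => tpDensity q (γs k) z) atTop (𝓝 (tpDensity q Γ z)) := by
  have hcross : Continuous fun p : ℂ × ℂ => |cross p.1 p.2| := by
    unfold cross
    fun_prop
  have hnum : Tendsto (fun k => |cross (deriv (γs k) z.2) (γs k z.1 - γs k z.2)|) atTop
      (𝓝 |cross (deriv Γ z.2) (Γ z.1 - Γ z.2)|) :=
    (hcross.tendsto (deriv Γ z.2, Γ z.1 - Γ z.2)).comp (h2.prodMk_nhds h1)
  have hden : Tendsto (fun k => ‖γs k z.2 - γs k z.1‖ ^ 2) atTop (𝓝 (‖Γ z.2 - Γ z.1‖ ^ 2)) := by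
    simp only [norm_sub_rev (γs _ z.2), norm_sub_rev (Γ z.2)]
    exact h1.norm.pow 2
  have hne : ‖Γ z.2 - Γ z.1‖ ^ 2 ≠ 0 :=
    pow_ne_zero 2 (norm_ne_zero_iff.2 (sub_ne_zero.2 h0.symm))
  exact ENNReal.tendsto_ofReal
    (((hnum.const_mul 2).div hden hne).rpow_const (Or.inr hq.le))

/-- Otherwise crossings of infinitely many `γs k` stay `δ'`-close to `z`. By compactness a
subsequence converges, and the uniform separation `ε` keeps the limit off the diagonal, so it is a
crossing of `Γ` within `δ' < δ` of `z`. The gap between the radii absorbs the loss of strictness in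
the limit. -/
theorem eventually_notMem_truncSet {γs : ℕ → ℝ → ℂ} {Γ : ℝ → ℂ} {a : ℕ → ℂ}
    (hΓ : TendstoC1 (fun k t => γs k t + a k) Γ) (hper : ∀ k, Function.Periodic (γs k) 1)
    (hn : ∀ k t, ‖deriv (γs k) t‖ = 1) (hnΓ : ∀ t, ‖deriv Γ t‖ = 1) {ε : ℝ} (hε : 0 < ε)
    (hsep : ∀ k, ∀ P ∈ crossings (γs k), ε ≤ ‖P.1 - P.2‖) {δ' δ : ℝ} (hδ : δ' < δ) {z : ℝ × ℝ}
    (hz : z ∉ truncSet Γ δ) : ∀ᶠ k in atTop, z ∉ truncSet (γs k) δ' := by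
  by_contra hcon
  simp only [not_eventually, not_not] at hcon
  obtain ⟨φ, hφ, hmem⟩ := extraction_of_frequently_atTop hcon
  have hrep : ∀ k, ∃ w : ℝ × ℝ, w ∈ Icc (0 : ℝ) 1 ×ˢ Icc (0 : ℝ) 1 ∧
      γs (φ k) w.1 = γs (φ k) w.2 ∧ ε ≤ ‖(w.1 : UnitAddCircle) - w.2‖ ∧
      ‖(z.1 : UnitAddCircle) - w.1‖ ≤ δ' ∧ ‖(z.2 : UnitAddCircle) - w.2‖ ≤ δ' := by
    intro k
    obtain ⟨P, hP, h1, h2⟩ := (mem_truncSet_iff (hper _) (hn _)).1 (hmem k)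
    have hP' := hsep _ P hP
    obtain ⟨u, v, rfl, hne, heq⟩ := hP
    obtain ⟨u', hu', hu⟩ := exists_mem_Ico_coe_eq u
    obtain ⟨v', hv', hv⟩ := exists_mem_Ico_coe_eq v
    refine ⟨(u', v'), ⟨Ico_subset_Icc_self hu', Ico_subset_Icc_self hv'⟩, ?_⟩
    simp only [hu, hv]
    rw [apply_eq_of_coe_eq (hper _) hu, apply_eq_of_coe_eq (hper _) hv]
    exact ⟨heq, hP', h1.le, h2.le⟩
  choose w hwI hweq hwε hw1 hw2 using hrep
  obtain ⟨p, -, ψ, hψ, hlim⟩ := (isCompact_Icc.prod isCompact_Icc).tendsto_subseq hwI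
  have hp1 : Tendsto (fun n => (w (ψ n)).1) atTop (𝓝 p.1) := hlim.fst_nhds
  have hp2 : Tendsto (fun n => (w (ψ n)).2) atTop (𝓝 p.2) := hlim.snd_nhds
  have hcoe : Continuous fun x : ℝ => (x : UnitAddCircle) := AddCircle.continuous_mk' 1
  have hc1 : Tendsto (fun n => ((w (ψ n)).1 : UnitAddCircle)) atTop (𝓝 (p.1 : UnitAddCircle)) :=
    (hcoe.tendsto p.1).comp hp1
  have hc2 : Tendsto (fun n => ((w (ψ n)).2 : UnitAddCircle)) atTop (𝓝 (p.2 : UnitAddCircle)) :=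
    (hcoe.tendsto p.2).comp hp2
  have hunif : TendstoUniformly (fun n t => γs (φ (ψ n)) t + a (φ (ψ n))) Γ atTop :=
    fun U hU => ((hφ.comp hψ).tendsto_atTop).eventually (hΓ.2.1 U hU)
  have hΓc : Continuous Γ := hΓ.1.contDiff.continuous
  have l1 := hunif.tendsto_comp hΓc.continuousAt hp1
  have l2 := hunif.tendsto_comp hΓc.continuousAt hp2
  have heq : Γ p.1 = Γ p.2 := by
    refine tendsto_nhds_unique l1 (l2.congr fun n => ?_)
    rw [hweq]
  have hsepΓ : ε ≤ ‖(p.1 : UnitAddCircle) - p.2‖ :=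
    ge_of_tendsto' (hc1.sub hc2).norm fun n => hwε _
  have hne : (p.1 : UnitAddCircle) ≠ p.2 := fun h => by
    rw [h, sub_self, norm_zero] at hsepΓ
    exact hsepΓ.not_gt hε
  refine hz ((mem_truncSet_iff hΓ.1.periodic hnΓ).2 ⟨_, ⟨p.1, p.2, rfl, hne, heq⟩, ?_, ?_⟩)
  · exact (le_of_tendsto' (tendsto_const_nhds.sub hc1).norm fun n => hw1 _).trans_lt hδ
  · exact (le_of_tendsto' (tendsto_const_nhds.sub hc2).norm fun n => hw2 _).trans_lt hδ

/-- Fatou's lemma for the truncated densities: off the truncation set of `Γ` they converge pointwise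
where `Γ z.1 ≠ Γ z.2`. The remaining points there lie on the diagonal. `Γ` itself need not be
admissible. -/
theorem truncEnergy_le_liminf {γs : ℕ → ℝ → ℂ} {Γ : ℝ → ℂ} {a : ℕ → ℂ}
    (hΓ : TendstoC1 (fun k t => γs k t + a k) Γ) (hγ : ∀ k, IsClosedC1 (γs k))
    (hn : ∀ k t, ‖deriv (γs k) t‖ = 1) {ε : ℝ} (hε : 0 < ε)
    (hsep : ∀ k, ∀ P ∈ crossings (γs k), ε ≤ ‖P.1 - P.2‖) {q : ℝ} (hq : 0 < q) {δ' δ : ℝ}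
    (hδ0 : 0 < δ) (hδ : δ' < δ) :
    truncEnergy q δ Γ ≤ liminf (fun k => truncEnergy q δ' (γs k)) atTop := by
  have hderiv : ∀ t, Tendsto (fun k => deriv (γs k) t) atTop (𝓝 (deriv Γ t)) := fun t => by
    simpa using hΓ.2.2.tendsto_at t
  have hdiff : ∀ x y, Tendsto (fun k => γs k x - γs k y) atTop (𝓝 (Γ x - Γ y)) := fun x y => by
    simpa using (hΓ.2.1.tendsto_at x).sub (hΓ.2.1.tendsto_at y)
  have hnΓ : ∀ t, ‖deriv Γ t‖ = 1 := fun t =>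
    tendsto_nhds_unique (hderiv t).norm (by simp [hn])
  set D : Set (ℝ × ℝ) := Ico (0 : ℝ) 1 ×ˢ Ico (0 : ℝ) 1 with hD
  have hDm : MeasurableSet D := measurableSet_Ico.prod measurableSet_Ico
  have hE : ∀ {β : ℝ → ℂ}, Function.Periodic β 1 → (∀ t, ‖deriv β t‖ = 1) → ∀ r : ℝ,
      truncEnergy q r β = ∫⁻ z in D, (truncSet β r)ᶜ.indicator (tpDensity q β) z := by
    intro β hβ hnβ r
    rw [truncEnergy_eq hnβ, setLIntegral_indicator (isOpen_truncSet hβ hnβ r).measurableSet.compl,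
      sdiff_eq, inter_comm]
  rw [hE hΓ.1.periodic hnΓ]
  simp only [hE (hγ _).periodic (hn _)]
  refine le_trans (setLIntegral_mono' hDm fun z hz => ?_) (lintegral_liminf_le fun k =>
    (measurable_tpDensity (hγ k).contDiff q).indicator
      (isOpen_truncSet (hγ k).periodic (hn k) δ').measurableSet.compl)
  by_cases hzY : z ∈ truncSet Γ δ
  · rw [indicator_of_notMem (by simpa using hzY)]
    exact zero_le
  rw [indicator_of_mem (by simpa using hzY)]
  by_cases h0 : Γ z.1 = Γ z.2
  · have hz12 : z.1 = z.2 := by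
      by_contra hne
      refine hzY ((mem_truncSet_iff hΓ.1.periodic hnΓ).2
        ⟨_, ⟨z.1, z.2, rfl, fun h => hne (coe_injOn_Ico hz.1 hz.2 h), h0⟩, ?_, ?_⟩) <;>
      simpa using hδ0
    -- On the diagonal the quotient is `0 / 0 = 0` by convention, and `0 ^ q = 0` for `q ≠ 0`.
    have : tpDensity q Γ z = 0 := by
      simp [tpDensity, hz12, Real.zero_rpow hq.ne']
    rw [this]
    exact zero_le
  · rw [← (tendsto_tpDensity hq h0 (hdiff _ _) (hderiv _)).liminf_eq]
    refine (liminf_congr ?_).le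
    filter_upwards [eventually_notMem_truncSet hΓ (fun k => (hγ k).periodic) hn hnΓ hε hsep hδ hzY]
      with k hk
    rw [indicator_of_mem (by simpa using hk)]

/-- Minimality at a small radius passes to every larger one against right-angled competitors: the
annuli cost the competitor no more than the minimizer, and this common cost is finite. -/
theorem truncEnergy_le_of_minimizer {jp jm s ω : ℤ} {η q : ℝ} (hη : 0 < η) (hq : 2 < q)
    {A : Set (ℝ → ℂ)} {β γ : ℝ → ℂ} {δ' δ : ℝ} (hδ'0 : 0 < δ') (hδ' : δ' ≤ δ) (hδ : δ ≤ η / 2)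
    (hβ : IsEnergyMinimizer q δ' (admissible η jp jm s ω ∩ A) β)
    (hγ : γ ∈ admissible η jp jm s ω ∩ A)
    (hcard : (crossings β).ncard = (crossings γ).ncard)
    (hangle : ∀ p ∈ selfInt γ, intersectionAngle γ p = Real.pi / 2) :
    truncEnergy q δ β ≤ truncEnergy q δ γ := by
  have h := (add_le_truncEnergy hβ.1.1 hη hq hδ'0 hδ' hδ).trans (hβ.2 γ hγ)
  rw [truncEnergy_eq_of_right_angles hγ.1 hη q hδ' hδ hangle, hcard] at h
  exact (ENNReal.add_le_add_iff_right (ENNReal.mul_ne_top (ENNReal.natCast_ne_top _)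
    (lineEnergy_right_angle_ne_top hq hδ'0 hδ'))).1 h

end PlaneCurve

end

/-! ### Conclusion: the limit of the minimizers against right-angled competitors -/

theorem corollary1p6 (jp jm s ω : ℤ) (C : Set (ℝ → ℂ))
    (hC : PlaneCurve.IsCompartment jp jm s ω C)
    (q : ℝ) (hq : 2 < q) (η : ℝ) (hη : η ∈ Set.Ioo (0 : ℝ) 1)
    -- truncation parameters tending to zero, with corresponding minimizers
    (δs : ℕ → ℝ) (hδs : ∀ k, δs k ∈ Set.Ioc 0 (η / 2))
    (hlim : Filter.Tendsto δs Filter.atTop (nhds 0))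
    (γs : ℕ → ℝ → ℂ)
    (hmin : ∀ k, PlaneCurve.IsEnergyMinimizer q (δs k)
      (PlaneCurve.admissible η jp jm s ω ∩ C) (γs k))
    -- the limit curve, after suitable translations
    (a : ℕ → ℂ) (Γ : ℝ → ℂ)
    (hΓ : PlaneCurve.TendstoC1 (fun k t => γs k t + a k) Γ) :
    ∀ δ ∈ Set.Ioc 0 (η / 2), ∀ γ ∈ PlaneCurve.admissible η jp jm s ω ∩ C,
      (∀ p ∈ PlaneCurve.selfInt γ, PlaneCurve.intersectionAngle γ p = Real.pi / 2) →
      PlaneCurve.truncEnergy q δ Γ ≤ PlaneCurve.truncEnergy q δ γ := by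
  intro δ hδ γ hγ hangle
  have hadm : ∀ k, γs k ∈ PlaneCurve.admissible η jp jm s ω := fun k => (hmin k).1.1
  have hcard : ∀ k, (PlaneCurve.crossings (γs k)).ncard = (PlaneCurve.crossings γ).ncard :=
    fun k => hC.ncard_crossings_eq (hmin k).1.2 hγ.2
  -- The intermediate radius satisfies `δs k < δ' < δ` for large `k`: the first inequality serves
  -- the comparison of minimizers, the second one semicontinuity.
  have hlt : ∀ δ' ∈ Set.Ioo 0 δ,
      PlaneCurve.truncEnergy q δ Γ ≤ PlaneCurve.truncEnergy q δ' γ := by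
    intro δ' hδ'
    refine (PlaneCurve.truncEnergy_le_liminf hΓ
      (fun k => (PlaneCurve.isGeneric_of_mem_admissible (hadm k)).toIsClosedC1)
      (fun k => PlaneCurve.norm_deriv_of_mem_admissible (hadm k))
      (by linarith [hη.1] : 0 < 2 * η)
      (fun k P hP => PlaneCurve.le_norm_fst_sub_snd (hadm k) hP) (by linarith : 0 < q)
      hδ.1 hδ'.2).trans ?_
    have hev : ∀ᶠ k in Filter.atTop,
        PlaneCurve.truncEnergy q δ' (γs k) ≤ PlaneCurve.truncEnergy q δ' γ := by
      filter_upwards [hlim.eventually (gt_mem_nhds hδ'.1)] with k hk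
      exact PlaneCurve.truncEnergy_le_of_minimizer hη.1 hq (hδs k).1 hk.le
        (hδ'.2.le.trans hδ.2) (hmin k) hγ (hcard k) hangle
    exact (Filter.liminf_le_liminf hev).trans_eq (Filter.liminf_const _)
  -- Left continuity in the radius holds for right-angled `γ` because its energy changes by a fixed
  -- multiple of the energy of a vanishing annulus, even when the energy itself is infinite.
  have hcont : Filter.Tendsto (fun δ' => PlaneCurve.truncEnergy q δ' γ)
      (nhdsWithin δ (Set.Iio δ)) (nhds (PlaneCurve.truncEnergy q δ γ)) := by
    have h := ((ENNReal.Tendsto.const_mul (PlaneCurve.tendsto_lineEnergy_right_angle hq hδ.1)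
      (Or.inr (ENNReal.natCast_ne_top (PlaneCurve.crossings γ).ncard))).const_add
      (PlaneCurve.truncEnergy q δ γ))
    rw [mul_zero, add_zero] at h
    refine h.congr' ?_
    filter_upwards [self_mem_nhdsWithin] with δ' hδ'
    exact (PlaneCurve.truncEnergy_eq_of_right_angles hγ.1 hη.1 q (le_of_lt hδ') hδ.2
      hangle).symm
  refine ge_of_tendsto hcont ?_
  filter_upwards [Ioo_mem_nhdsLT hδ.1] with δ' hδ'
  exact hlt δ' hδ'
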